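/- Let $K$ be a number field with algebraic closure $\overline K$, let $b\in K$, $b\neq 0$, and let $\mathcal E_1: y^2=x^3+bx$. Let $K_7=K(\mathcal E_1[7])$ be the field obtained from $K$ by adjoining the coordinates of all $7$-torsion points of $\mathcal E_1(\overline K)$. Let $i\in\overline K$ be a root of $x^2+1$, let $\zeta_7\in\overline K$ be a primitive $7$-th root of unity, and put $$\omega_1=(6i+4)\zeta_7^5+(6i-2)\zeta_7^4+(2i-2)\zeta_7^3+(2i+4)\zeta_7^2+8i\zeta_7+4i-3,$$ $$\theta_1=\tfrac17\big((-3520i-1568)\zeta_7^5+(-4800i+2352)\zeta_7^4+(-256i+2352)\zeta_7^3+(-1536i-1568)\zeta_7^2-5056i\zeta_7-2528i+3584\big).$$ For an arbitrary choice of the square roots in $\overline K$ let $\sqrt{\theta_1}$ be a square root of $\theta_1$, let $x_1=\sqrt{\omega_1b+\tfrac12b\sqrt{\theta_1}}$ and $y_1=\sqrt{(\omega_1+\tfrac12\sqrt{\theta_1}+1)\,b\,x_1}$. Consider the conditions - **A.** $i\notin K$; - **B1.** $\zeta_7+\zeta_7^{-1}\notin K(i)$; - **B2.** $\zeta_7\notin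 K(i,\zeta_7+\zeta_7^{-1})$; - **C.** $\sqrt{\theta_1}\notin K(i,\zeta_7)$; - **D.** $x_1\notin K(i,\zeta_7,\sqrt{\theta_1})$; - **E.** $y_1\notin K(i,\zeta_7,x_1)$. Then the possible degrees $[K_7:K]$ are exactly $96, 48, 32, 24, 16, 12, 8, 6, 4, 3, 2, 1$: the degree always is one of these numbers, and each of them is the degree $[K_7:K]$ for some number field $K$ and some nonzero $b\in K$. Moreover, for every $K$ and $b$ and every $d$, one has $[K_7:K]=d$ if and only if the set of those conditions among A, B1, B2, C, D, E that hold (all the others failing) is one of the sets listed for $d$ in the following table, where "$k$ among" means exactly $k$: - $d=96$: A, B1, B2, C, D, E; - $d=48$: B1, E and three among A, B2, C, D; - $d=32$: A, B2, C, D, E; - $d=24$: B1, E, C, D; or B1, E, one of A and B2, and one of C and D; - $d=16$: E and three among A, B2, C, D; - $d=12$: B1, E and one among A, B2, C, D; - $d=8$: E and two among A, B2, C, D; - $d=6$: B1 and one among A, B2, E; - $d=4$: A, B2; or E and one among A, B2, C, D; - $d=3$: B1; - $d=2$: one among A, B2, E; - $d=1$: no condition holds. (It is not claimed that every set in the table occurs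 for some $K$ and $b$.) -/

import Mathlib

namespace DivisionFieldSeven

/-- The curve `y² = x³ + b x`. -/
def curve {K : Type*} [Field K] (b : K) : WeierstrassCurve K :=
  ⟨0, 0, 0, b, 0⟩

open scoped Classical in
/-- The `m`-th division field `K(E[m])` inside an extension `L` of `K` (in the theorem `L` is an
algebraic closure of `K`): `K` with the coordinates of all affine points of `E(L)` killed by `m`
adjoined. -/
noncomputable def divisionField {K : Type*} [Field K] (W : WeierstrassCurve K)
    (L : Type*) [Field L] [Algebra K L] (m : ℕ) : IntermediateField K L :=
  IntermediateField.adjoin K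
    {z : L | ∃ (x y : L) (h : (W.baseChange L).toAffine.Nonsingular x y),
      m • (WeierstrassCurve.Affine.Point.some x y h : (W.baseChange L).toAffine.Point) = 0 ∧
        (z = x ∨ z = y)}

/-- The number `ω₁`, for a square root `i` of `-1` and a primitive seventh root of unity `ζ`. -/
def omegaOne {L : Type*} [Field L] (i ζ : L) : L :=
  (6 * i + 4) * ζ ^ 5 + (6 * i - 2) * ζ ^ 4 + (2 * i - 2) * ζ ^ 3 + (2 * i + 4) * ζ ^ 2
    + 8 * i * ζ + 4 * i - 3

/-- The number `θ₁`, for a square root `i` of `-1` and a primitive seventh root of unity `ζ`. -/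
def thetaOne {L : Type*} [Field L] (i ζ : L) : L :=
  1 / 7 * ((-3520 * i - 1568) * ζ ^ 5 + (-4800 * i + 2352) * ζ ^ 4 + (-256 * i + 2352) * ζ ^ 3
    + (-1536 * i - 1568) * ζ ^ 2 - 5056 * i * ζ - 2528 * i + 3584)

/-- The names of the six conditions. -/
inductive Cond
  | A | B1 | B2 | C | D | E
  deriving DecidableEq

instance : Fintype Cond :=
  ⟨{Cond.A, Cond.B1, Cond.B2, Cond.C, Cond.D, Cond.E}, fun c => by cases c <;> decide⟩

/-- The six conditions on `K`. Here `s` is a square root of `θ₁`, `x₁` a square root of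
`ω₁ b + b s / 2`, and `y₁` a square root of `(ω₁ + s / 2 + 1) b x₁`. -/
def Cond.Holds (K : Type*) [Field K] {L : Type*} [Field L] [Algebra K L] (i ζ s x₁ y₁ : L) :
    Cond → Prop
  | .A => i ∉ (⊥ : IntermediateField K L)
  | .B1 => ζ + ζ⁻¹ ∉ IntermediateField.adjoin K {i}
  | .B2 => ζ ∉ IntermediateField.adjoin K {i, ζ + ζ⁻¹}
  | .C => s ∉ IntermediateField.adjoin K {i, ζ}
  | .D => x₁ ∉ IntermediateField.adjoin K {i, ζ, s}
  | .E => y₁ ∉ IntermediateField.adjoin K {i, ζ, x₁}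

open scoped Classical in
/-- The set of those among the six conditions that hold. -/
noncomputable def holding (K : Type*) [Field K] {L : Type*} [Field L] [Algebra K L]
    (i ζ s x₁ y₁ : L) : Finset Cond :=
  Finset.univ.filter fun c => c.Holds K i ζ s x₁ y₁

open Cond in
/-- The table: `Table d T` says that `T` is one of the sets of conditions listed for the
degree `d`. -/
inductive Table : ℕ → Finset Cond → Prop
  | deg96 : Table 96 {A, B1, B2, C, D, E}
  | deg48 (S : Finset Cond) (hS : S ⊆ {A, B2, C, D}) (h : S.card = 3) : Table 48 ({B1, E} ∪ S)
  | deg32 : Table 32 {A, B2, C, D, E}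
  | deg24 : Table 24 {B1, E, C, D}
  | deg24' (p q : Cond) (hp : p = A ∨ p = B2) (hq : q = C ∨ q = D) : Table 24 {B1, E, p, q}
  | deg16 (S : Finset Cond) (hS : S ⊆ {A, B2, C, D}) (h : S.card = 3) : Table 16 ({E} ∪ S)
  | deg12 (p : Cond) (hp : p = A ∨ p = B2 ∨ p = C ∨ p = D) : Table 12 {B1, E, p}
  | deg8 (S : Finset Cond) (hS : S ⊆ {A, B2, C, D}) (h : S.card = 2) : Table 8 ({E} ∪ S)
  | deg6 (p : Cond) (hp : p = A ∨ p = B2 ∨ p = E) : Table 6 {B1, p}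
  | deg4 : Table 4 {A, B2}
  | deg4' (p : Cond) (hp : p = A ∨ p = B2 ∨ p = C ∨ p = D) : Table 4 {E, p}
  | deg3 : Table 3 {B1}
  | deg2 (p : Cond) (hp : p = A ∨ p = B2 ∨ p = E) : Table 2 {p}
  | deg1 : Table 1 ∅

/-- The list of degrees in the table. -/
def degrees : Finset ℕ := {96, 48, 32, 24, 16, 12, 8, 6, 4, 3, 2, 1}

end DivisionFieldSeven

/-
The endomorphism `(x, y) ↦ (-x, i y)` makes the `7`-torsion of `y² = x³ + b x` a module over
`ℤ[i] / 7`. Since `7` is inert in `ℤ[i]`, this ring is the field with `49` elements, and the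
`7`-torsion, having at most `49` points, is the line spanned by `P = (x₁, y₁)`. Hence
`K₇ = K(i, x₁, y₁)`, and eliminating `ζ₇ ^ 2 + ζ₇ ^ 5` and `i (ζ₇ - ζ₇⁻¹)` from the equations
between them and `x₁ ^ 2 / b` shows that `K₇` contains `ζ₇`.

So `K₇` is the top of the tower `K ⊆ K(i) ⊆ K(i, ζ₇ + ζ₇⁻¹) ⊆ K(i, ζ₇) ⊆ K(i, ζ₇, √θ₁) ⊆
K(i, ζ₇, x₁) ⊆ K(i, ζ₇, x₁, y₁)`, in which the condition attached to a step says that it is not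
trivial, and then its degree is `3` for B1 and `2` otherwise. The last four steps adjoin square
roots `√c`, `√(p + q √c)` with `c (p² - q² c)` minus a square, hence a square as `i` is present. If
the second of these lies in `F(√c)`, then the norm `p² - q² c` is a square of `F` (if `√c ∉ F`),
hence so is `c`. This gives the implications B2 → C → D → E, and the twenty sets of conditions that
satisfy them are in the table.

Over `ℚ` all conditions hold, so the Galois group of `ℚ₇` has order `96`. The automorphisms fixing
`i` are `ℤ[i]`-linear on the torsion line, so they form an abelian subgroup, of order `48`, and
fixed fields of subgroups realise every degree in the table.
-/

namespace DivisionFieldSeven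

section Arithmetic

variable {L : Type*} [Field L]

/-- The number `ζ² + ζ⁻²`, a generator of the real cubic subfield of `ℚ(ζ)`. -/
def cosGen (ζ : L) : L := ζ ^ 2 + ζ ^ 5

/-- The number `i (ζ - ζ⁻¹)`, a generator of the maximal real subfield of `ℚ(i, ζ)`. -/
def sinGen (i ζ : L) : L := i * (ζ - ζ ^ 6)

/-- The polynomial of degree `12` with `ψ₇ = b ^ 12 * psiSeven (x ^ 2 / b)` for the seventh division
polynomial `ψ₇` of `y² = x³ + b x`. -/
def psiSeven (u : L) : L :=
  7 * u ^ 12 + 308 * u ^ 11 - 2954 * u ^ 10 - 19852 * u ^ 9 - 35231 * u ^ 8 - 82264 * u ^ 7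
    - 111916 * u ^ 6 - 42168 * u ^ 5 + 15673 * u ^ 4 + 14756 * u ^ 3 + 1302 * u ^ 2 + 196 * u - 1

theorem cyclotomic_seven_relation {ζ : L} (h : IsPrimitiveRoot ζ 7) :
    ζ ^ 6 + ζ ^ 5 + ζ ^ 4 + ζ ^ 3 + ζ ^ 2 + ζ + 1 = 0 := by
  have h' := h.geom_sum_eq_zero (by norm_num)
  simp only [Finset.sum_range_succ, Finset.sum_range_zero] at h'
  linear_combination h'

theorem inv_eq_pow_six {ζ : L} (h : IsPrimitiveRoot ζ 7) : ζ⁻¹ = ζ ^ 6 :=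
  inv_eq_of_mul_eq_one_right (by rw [← pow_succ', h.pow_eq_one])

theorem seven_ne_zero_of_isPrimitiveRoot {ζ : L} (h : IsPrimitiveRoot ζ 7) : (7 : L) ≠ 0 :=
  mod_cast h.neZero'.ne

theorem cosGen_cubic {ζ : L} (h : IsPrimitiveRoot ζ 7) :
    cosGen ζ ^ 3 + cosGen ζ ^ 2 - 2 * cosGen ζ - 1 = 0 := by
  unfold cosGen
  linear_combination (ζ ^ 9 - ζ ^ 8 + 3 * ζ ^ 6 - 3 * ζ ^ 5 + ζ ^ 4 + 2 * ζ ^ 3 - 2 * ζ ^ 2 + ζ - 1)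
    * cyclotomic_seven_relation h

theorem cosGen_eq {ζ : L} (h : IsPrimitiveRoot ζ 7) : cosGen ζ = (ζ + ζ⁻¹) ^ 2 - 2 := by
  rw [inv_eq_pow_six h, cosGen]
  linear_combination (-2 - ζ ^ 5) * h.pow_eq_one

theorem add_inv_cubic {ζ : L} (h : IsPrimitiveRoot ζ 7) :
    (ζ + ζ⁻¹) ^ 3 + (ζ + ζ⁻¹) ^ 2 - 2 * (ζ + ζ⁻¹) - 1 = 0 := by
  rw [inv_eq_pow_six h]
  linear_combination (-1 + ζ ^ 12 - ζ ^ 11 + 3 * ζ ^ 7 - 2 * ζ ^ 6 - ζ ^ 4 + 3 * ζ ^ 2 - ζ)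
    * cyclotomic_seven_relation h

theorem sinGen_sq {i ζ : L} (hi : i ^ 2 = -1) (h : IsPrimitiveRoot ζ 7) :
    sinGen i ζ ^ 2 = 2 - cosGen ζ := by
  unfold sinGen cosGen
  linear_combination (ζ - ζ ^ 6) ^ 2 * hi + (2 - ζ ^ 5) * h.pow_eq_one

theorem two_mul_zeta_eq {i ζ : L} (hi : i ^ 2 = -1) (h : IsPrimitiveRoot ζ 7) :
    2 * ζ = (cosGen ζ ^ 2 - 2) ^ 2 - 2 - i * sinGen i ζ := by
  have hc : cosGen ζ ^ 2 - 2 = ζ ^ 4 + ζ ^ 3 := by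
    unfold cosGen
    linear_combination (2 + ζ ^ 3) * h.pow_eq_one
  rw [hc, sinGen]
  linear_combination (-2 - ζ) * h.pow_eq_one + (ζ - ζ ^ 6) * hi

theorem omegaOne_eq {i ζ : L} (h : IsPrimitiveRoot ζ 7) :
    omegaOne i ζ = 1 + 4 * cosGen ζ - 2 * cosGen ζ ^ 2 + 2 * cosGen ζ ^ 2 * sinGen i ζ := by
  unfold omegaOne cosGen sinGen
  linear_combination (2 * i * ζ ^ 10 - 2 * i * ζ ^ 9 + 4 * i * ζ ^ 7 - 4 * i * ζ ^ 6 - 2 * i * ζ ^ 5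
    + 4 * i * ζ ^ 4 + 2 * ζ ^ 4 - 6 * i * ζ ^ 2 - 2 * ζ ^ 3 + 4 * i * ζ + 4 * i + 4 * ζ - 4)
    * cyclotomic_seven_relation h

theorem sinGen_mul_thetaOne {i ζ : L} (hi : i ^ 2 = -1) (h : IsPrimitiveRoot ζ 7) :
    sinGen i ζ * thetaOne i ζ = 16 * (sinGen i ζ * (21 * cosGen ζ ^ 2 - 14 * cosGen ζ - 10)
      + (22 + 34 * cosGen ζ - 38 * cosGen ζ ^ 2)) := by
  have h7 := seven_ne_zero_of_isPrimitiveRoot h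
  unfold sinGen cosGen thetaOne
  field_simp
  linear_combination (3520 * ζ ^ 11 + 4800 * ζ ^ 10 + 256 * ζ ^ 9 + 1536 * ζ ^ 8 + 5056 * ζ ^ 7
    - 992 * ζ ^ 6 - 4800 * ζ ^ 5 - 256 * ζ ^ 4 - 1536 * ζ ^ 3 - 5056 * ζ ^ 2 - 2528 * ζ) * hi
    + (2352 * i * ζ ^ 10 - 2352 * i * ζ ^ 9 + 4704 * i * ζ ^ 7 - 4704 * i * ζ ^ 6 - 2352 * i * ζ ^ 5
    + 2352 * i * ζ ^ 4 - 3520 * ζ ^ 5 + 2976 * ζ ^ 4 - 4704 * i * ζ ^ 2 + 288 * ζ ^ 3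
    + 4704 * i * ζ - 1280 * ζ ^ 2 + 4992 * ζ - 2464) * cyclotomic_seven_relation h

/-- The cubic relation of `t = ζ² + ζ⁻²`, the quadratic relation of `ρ = i (ζ - ζ⁻¹)` over `ℚ(t)`,
and the quadratic relation of `u = x₁² / b` over `ℚ(ρ)`, cleared of denominators. -/
structure IsSevenTriple (t ρ u : L) : Prop where
  cubic : t ^ 3 + t ^ 2 - 2 * t - 1 = 0
  sq : ρ ^ 2 = 2 - t
  quadratic : ρ * (u ^ 2 - 2 * (1 + 4 * t - 2 * t ^ 2) * u + 1 - 4 * t ^ 2)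
    + 4 * ((1 + 2 * t - 3 * t ^ 2) * u + t ^ 2 - 2 * t - 1) = 0

/-- The norm form of the cubic field generated by a root of `X³ + X² - 2X - 1`. -/
def cubicNorm (a b c : L) : L :=
  a ^ 3 + b ^ 3 + c ^ 3 - a ^ 2 * b + 5 * a ^ 2 * c - 2 * a * b ^ 2 + 6 * a * c ^ 2 - b ^ 2 * c
    - 2 * b * c ^ 2 - a * b * c

variable {t ρ u : L}

theorem cubicNorm_eq_zero (ht : t ^ 3 + t ^ 2 - 2 * t - 1 = 0) {a b c : L}
    (h : a + b * t + c * t ^ 2 = 0) : cubicNorm a b c = 0 := by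
  unfold cubicNorm
  linear_combination (-a * c * t ^ 2 + b ^ 2 * t ^ 2 - b * c * t ^ 2 - 2 * c ^ 2 * t ^ 2 - a * b * t
      + b ^ 2 * t - b * c * t - c ^ 2 * t + a ^ 2 - a * b + 5 * a * c - 2 * b ^ 2 + b * c
      + 5 * c ^ 2) * h
    + (a * c ^ 2 * t - b ^ 2 * c * t + b * c ^ 2 * t + 2 * c ^ 3 * t + 2 * a * b * c - a * c ^ 2
      - b ^ 3 + b ^ 2 * c + 2 * b * c ^ 2 - c ^ 3) * ht

theorem ne_zero_of_sq_eq_two_sub (h7 : (7 : L) ≠ 0) (ht : t ^ 3 + t ^ 2 - 2 * t - 1 = 0)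
    (hρ : ρ ^ 2 = 2 - t) : ρ ≠ 0 := by
  rintro rfl
  exact h7 (by linear_combination (-t ^ 2 - 3 * t - 4) * hρ + ht)

theorem IsSevenTriple.of_four_mul_sq [NeZero (2 : L)] (ht : t ^ 3 + t ^ 2 - 2 * t - 1 = 0)
    (hρ : ρ ^ 2 = 2 - t)
    (hu : 4 * ρ * (u - (1 + 4 * t - 2 * t ^ 2 + 2 * t ^ 2 * ρ)) ^ 2
      = 16 * (ρ * (21 * t ^ 2 - 14 * t - 10) + (22 + 34 * t - 38 * t ^ 2))) :
    IsSevenTriple t ρ u := by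
  refine ⟨ht, hρ, mul_left_cancel₀ (pow_ne_zero 2 two_ne_zero) ?_⟩
  linear_combination hu
    - (16 * ρ * t ^ 4 - 32 * t ^ 4 - 16 * u * t ^ 2 + 64 * t ^ 3 + 16 * t ^ 2) * hρ
    - (-16 * ρ * t ^ 2 + 64 * ρ * t + 32 * t ^ 2 + 16 * u - 160 * ρ - 160 * t + 336) * ht

theorem IsSevenTriple.quartic (h : IsSevenTriple t ρ u) :
    (2 * u ^ 4 - 16 * u ^ 3 + 20 * u ^ 2 - 6) + (-u ^ 4 - 44 * u ^ 3 + 10 * u ^ 2 - 12 * u - 17) * t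
      + (40 * u ^ 3 - 24 * u ^ 2 - 8 * u - 8) * t ^ 2 = 0 := by
  have hsq : (2 - t) * (u ^ 2 - 2 * (1 + 4 * t - 2 * t ^ 2) * u + 1 - 4 * t ^ 2) ^ 2
      = (4 * ((1 + 2 * t - 3 * t ^ 2) * u + t ^ 2 - 2 * t - 1)) ^ 2 := by
    rw [← h.sq, ← mul_pow, eq_neg_of_add_eq_zero_left h.quadratic, neg_sq]
  linear_combination hsq - (-16 * u ^ 2 * t ^ 2 - 8 * u ^ 3 - 32 * u ^ 2 * t + 32 * u * t ^ 2
    + 24 * u ^ 2 - 64 * u * t - 16 * t ^ 2 - 24 * u + 32 * t + 8) * h.cubic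

-- `psiSeven u` is the norm of the left-hand side of `IsSevenTriple.quartic` down to `ℚ(u)`.
theorem IsSevenTriple.psiSeven_eq_zero (h : IsSevenTriple t ρ u) : psiSeven u = 0 := by
  have hN := cubicNorm_eq_zero h.cubic h.quartic
  unfold cubicNorm at hN
  unfold psiSeven
  linear_combination hN

theorem IsSevenTriple.quadratic_coeff_ne_zero [NeZero (2 : L)] (h : IsSevenTriple t ρ u) :
    u ^ 2 - 2 * (1 + 4 * t - 2 * t ^ 2) * u + 1 - 4 * t ^ 2 ≠ 0 := by
  intro hA
  have hB : (1 + 2 * t - 3 * t ^ 2) * u + t ^ 2 - 2 * t - 1 = 0 :=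
    mul_left_cancel₀ (pow_ne_zero 2 two_ne_zero) (by linear_combination h.quadratic - ρ * hA)
  -- Eliminating `u` from `hA` and `hB` leaves `4` times a unit of `ℤ[t]`.
  have helim : 4 * (3 * t ^ 2 - t - 1) = 0 := by
    linear_combination (1 + 2 * t - 3 * t ^ 2) ^ 2 * hA
      - ((1 + 2 * t - 3 * t ^ 2) * u - (t ^ 2 - 2 * t - 1)
        - 2 * (1 + 4 * t - 2 * t ^ 2) * (1 + 2 * t - 3 * t ^ 2)) * hB
      - (-24 * t ^ 3 + 16 * t ^ 2 + 12 * t - 4) * h.cubic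
  refine pow_ne_zero 2 (two_ne_zero (α := L)) ?_
  linear_combination (25 - 6 * t - 11 * t ^ 2) * helim - 4 * (26 - 33 * t) * h.cubic

theorem neg_theta_mul_norm (ht : t ^ 3 + t ^ 2 - 2 * t - 1 = 0) (hρ : ρ ^ 2 = 2 - t) {ω θ : L}
    (hω : ω = 1 + 4 * t - 2 * t ^ 2 + 2 * t ^ 2 * ρ)
    (hθ : ρ * θ = 16 * (ρ * (21 * t ^ 2 - 14 * t - 10) + (22 + 34 * t - 38 * t ^ 2))) :
    -(ρ ^ 2 * (θ * (4 * ω ^ 2 - θ)))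
      = (8 * (9 + 14 * t - 14 * t ^ 2 + ρ * (9 * t ^ 2 - 3 * t - 3))) ^ 2 := by
  have hρθ : -(ρ ^ 2 * (θ * (4 * ω ^ 2 - θ))) = -(ρ * θ) * (4 * ρ * ω ^ 2 - ρ * θ) := by ring
  rw [hρθ, hθ, hω]
  linear_combination (-5376 * ρ ^ 2 * t ^ 6 + 3584 * ρ ^ 2 * t ^ 5 + 20480 * ρ * t ^ 6
      + 5376 * t ^ 7 + 2560 * ρ ^ 2 * t ^ 4 - 37376 * ρ * t ^ 5 - 39168 * t ^ 6 - 1792 * ρ * t ^ 4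
      + 86016 * t ^ 5 + 13824 * ρ * t ^ 3 + 71104 * t ^ 4 + 2560 * ρ * t ^ 2 - 188544 * t ^ 3
      - 46592 * t ^ 2 + 76544 * t + 25664) * hρ
    + (-20480 * ρ * t ^ 4 - 5376 * t ^ 5 + 108544 * ρ * t ^ 3 + 55296 * t ^ 4 - 270080 * ρ * t ^ 2
      - 230400 * t ^ 3 + 115200 * ρ * t + 436544 * t ^ 2 + 110592 * ρ - 154176 * t - 170048) * ht

theorem sqrt_theta_mul_norm_ne_zero [NeZero (2 : L)] (ht : t ^ 3 + t ^ 2 - 2 * t - 1 = 0)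
    (hρ : ρ ^ 2 = 2 - t) :
    8 * (9 + 14 * t - 14 * t ^ 2 + ρ * (9 * t ^ 2 - 3 * t - 3)) ≠ 0 := by
  rw [show (8 : L) = 2 ^ 3 by norm_num]
  refine mul_ne_zero (pow_ne_zero 3 two_ne_zero) fun hm => ?_
  have hnorm : -3 * t ^ 2 - 8 * t - 3 = 0 := by
    linear_combination (9 + 14 * t - 14 * t ^ 2 - ρ * (9 * t ^ 2 - 3 * t - 3)) * hm
      + (81 * t ^ 4 - 54 * t ^ 3 - 45 * t ^ 2 + 18 * t + 9) * hρ
      + (-81 * t ^ 2 + 101 * t + 66) * ht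
  refine one_ne_zero (α := L) ?_
  linear_combination (13 * t ^ 2 + 7 * t - 29) * hnorm + (39 * t + 86) * ht

theorem odd_sq_sub_even_sq (ht : t ^ 3 + t ^ 2 - 2 * t - 1 = 0) :
    (22 + 34 * t - 38 * t ^ 2) ^ 2 - (2 - t) * (21 * t ^ 2 - 14 * t - 10) ^ 2
      = (t ^ 2 + t) ^ 2 := by
  linear_combination (441 * t ^ 2 - 468 * t - 284) * ht

theorem sq_add_self_ne_zero (ht : t ^ 3 + t ^ 2 - 2 * t - 1 = 0) : t ^ 2 + t ≠ 0 := by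
  intro h
  refine one_ne_zero (α := L) ?_
  linear_combination (2 * t ^ 2 + t - 4) * h - (2 * t + 1) * ht

theorem ne_zero_of_psiSeven (hψ : psiSeven u = 0) : u ≠ 0 := by
  rintro rfl
  simp [psiSeven] at hψ

theorem sub_one_ne_zero_of_psiSeven [NeZero (2 : L)] (hψ : psiSeven u = 0) : u - 1 ≠ 0 := by
  have h1 : psiSeven (1 : L) = -2 ^ 18 := by norm_num [psiSeven]
  rw [sub_ne_zero]
  rintro rfl
  simp [h1, two_ne_zero] at hψ

theorem quartic_coeff_ne_zero_of_psiSeven [NeZero (2 : L)] (hψ : psiSeven u = 0) :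
    2 * u ^ 4 - 16 * u ^ 3 + 20 * u ^ 2 - 6 ≠ 0 ∨ 40 * u ^ 3 - 24 * u ^ 2 - 8 * u - 8 ≠ 0 := by
  have h2 : (2 : L) ≠ 0 := two_ne_zero
  have hu := sub_one_ne_zero_of_psiSeven hψ
  by_contra! h
  have ha : u ^ 2 - 6 * u - 3 = 0 := by
    refine (mul_eq_zero_iff_left (mul_ne_zero h2 (pow_ne_zero 2 hu))).1 ?_
    linear_combination h.1
  have hc : 5 * u ^ 2 + 2 * u + 1 = 0 := by
    refine (mul_eq_zero_iff_left (mul_ne_zero (pow_ne_zero 3 h2) hu)).1 ?_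
    linear_combination h.2
  have hu' : 2 * u + 1 = 0 := by
    refine (mul_eq_zero_iff_left (pow_ne_zero 4 h2)).1 ?_
    linear_combination hc - 5 * ha
  exact one_ne_zero (α := L) (by linear_combination 4 * ha - (2 * u - 13) * hu')

theorem add_one_ne_zero_of_psiSeven [NeZero (2 : L)] (hψ : psiSeven u = 0) : u + 1 ≠ 0 := by
  have h1 : psiSeven (-1 : L) = -2 ^ 12 := by norm_num [psiSeven]
  rw [Ne, add_eq_zero_iff_eq_neg]
  rintro rfl
  simp [h1, two_ne_zero] at hψ

theorem psiThree_ne_zero_of_psiSeven [NeZero (2 : L)] (hψ : psiSeven u = 0) :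
    3 * u ^ 2 + 6 * u - 1 ≠ 0 := by
  rw [psiSeven] at hψ
  intro h
  refine pow_ne_zero 24 (two_ne_zero (α := L)) ?_
  linear_combination (61236 * u + 131949) * hψ + (-142884 * u ^ 11 - 6309009 * u ^ 10
    + 59320674 * u ^ 9 + 414400455 * u ^ 8 + 783258336 * u ^ 7 + 1800354654 * u ^ 6
    + 2563023708 * u ^ 5 + 1257205446 * u ^ 4 - 125311788 * u ^ 3 - 320852973 * u ^ 2
    - 75654222 * u - 16909165) * h

theorem psiFour_factor_ne_zero_of_psiSeven [NeZero (2 : L)] (hψ : psiSeven u = 0) :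
    u ^ 2 + 6 * u + 1 ≠ 0 := by
  rw [psiSeven] at hψ
  intro h
  refine pow_ne_zero 21 (two_ne_zero (α := L)) ?_
  linear_combination (-6930 * u - 40391) * hψ + (48510 * u ^ 11 + 2126117 * u ^ 10
    - 20836004 * u ^ 9 - 133999467 * u ^ 8 - 221160156 * u ^ 7 - 532144438 * u ^ 6
    - 684276320 * u ^ 5 - 174821038 * u ^ 4 + 138608750 * u ^ 3 + 78475761 * u ^ 2
    - 4430860 * u + 2056761) * h

end Arithmetic

section Points

/-- The short Weierstrass curves `y² = x³ + a₄ x`, which are those of `j`-invariant `1728` when they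
are nonsingular. Working with a class avoids transporting points along
`(curve b).baseChange L = curve (algebraMap K L b)`. -/
class IsJ1728NF {R : Type*} [CommRing R] (W : WeierstrassCurve R) : Prop extends W.IsShortNF where
  a₆ : W.a₆ = 0

instance {K : Type*} [Field K] (b : K) : IsJ1728NF (curve b) where
  a₁ := rfl
  a₂ := rfl
  a₃ := rfl
  a₆ := rfl

instance {R S : Type*} [CommRing R] [CommRing S] (f : R →+* S) (W : WeierstrassCurve R)
    [IsJ1728NF W] : IsJ1728NF (W.map f) where
  a₁ := by simp
  a₂ := by simp
  a₃ := by simp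
  a₆ := by simp [IsJ1728NF.a₆]

instance {R S : Type*} [CommRing R] [CommRing S] [Algebra R S] (W : WeierstrassCurve R)
    [IsJ1728NF W] : IsJ1728NF (W.baseChange S) :=
  inferInstanceAs (IsJ1728NF (W.map (algebraMap R S)))

/-- The abscissa of `2P` for a point `P = (x, y)` of `y² = x³ + β x` with `y ≠ 0`. -/
def doubleX {L : Type*} [Field L] (β x y : L) : L := (x ^ 2 - β) ^ 2 / (2 * y) ^ 2

/-- The ordinate of `2P` for a point `P = (x, y)` of `y² = x³ + β x` with `y ≠ 0`. -/
def doubleY {L : Type*} [Field L] (β x y : L) : L :=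
  (x ^ 2 - β) * (x ^ 4 + 6 * β * x ^ 2 + β ^ 2) / (2 * y) ^ 3

/-- The third division polynomial of `y² = x³ + β x`. -/
def divPolyThree {R : Type*} [CommRing R] (β x : R) : R := 3 * x ^ 4 + 6 * β * x ^ 2 - β ^ 2

/-- The abscissa of `3P` for a point `P = (x, y)` of `y² = x³ + β x` which is not killed by `3`. -/
def tripleX {L : Type*} [Field L] (β x : L) : L :=
  x * (x ^ 4 - 6 * β * x ^ 2 - 3 * β ^ 2) ^ 2 / divPolyThree β x ^ 2

/-- The seventh division polynomial of `y² = x³ + β x`. -/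
def divPolySeven {R : Type*} [CommRing R] (β x : R) : R :=
  7 * x ^ 24 + 308 * β * x ^ 22 - 2954 * β ^ 2 * x ^ 20 - 19852 * β ^ 3 * x ^ 18
    - 35231 * β ^ 4 * x ^ 16 - 82264 * β ^ 5 * x ^ 14 - 111916 * β ^ 6 * x ^ 12
    - 42168 * β ^ 7 * x ^ 10 + 15673 * β ^ 8 * x ^ 8 + 14756 * β ^ 9 * x ^ 6
    + 1302 * β ^ 10 * x ^ 4 + 196 * β ^ 11 * x ^ 2 - β ^ 12

variable {L : Type*} [Field L] {β x y : L}

theorem divPolySeven_eq {u : L} (hu : x ^ 2 = β * u) :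
    divPolySeven β x = β ^ 12 * psiSeven u := by
  have hpow (n : ℕ) : x ^ (2 * n) = β ^ n * u ^ n := by rw [pow_mul, hu, mul_pow]
  rw [divPolySeven, psiSeven, hpow 12, hpow 11, hpow 10, hpow 9, hpow 8, hpow 7, hpow 6, hpow 5,
    hpow 4, hpow 3, hpow 2, hu]
  ring

theorem doubleX_sub [NeZero (2 : L)] (he : y ^ 2 = x ^ 3 + β * x) (hy : y ≠ 0) :
    doubleX β x y - x = -divPolyThree β x / (2 * y) ^ 2 := by
  have h2 : (2 : L) ≠ 0 := two_ne_zero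
  unfold doubleX divPolyThree
  field_simp
  linear_combination (-4 * x) * he

theorem doubleX_ne [NeZero (2 : L)] (he : y ^ 2 = x ^ 3 + β * x) (hy : y ≠ 0)
    (h3 : divPolyThree β x ≠ 0) : doubleX β x y ≠ x := by
  rw [← sub_ne_zero, doubleX_sub he hy]
  exact div_ne_zero (neg_ne_zero.2 h3) (pow_ne_zero 2 (mul_ne_zero two_ne_zero hy))

theorem slope_double [DecidableEq L] [NeZero (2 : L)] (W : WeierstrassCurve.Affine L)
    (he : y ^ 2 = x ^ 3 + β * x) (hy : y ≠ 0) (h3 : divPolyThree β x ≠ 0) :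
    W.slope (doubleX β x y) x (doubleY β x y) y
      = (7 * x ^ 6 + 11 * β * x ^ 4 + 13 * β ^ 2 * x ^ 2 + β ^ 3)
        / (2 * y * divPolyThree β x) := by
  have h2 : (2 : L) ≠ 0 := two_ne_zero
  rw [WeierstrassCurve.Affine.slope_of_X_ne (doubleX_ne he hy h3), doubleX_sub he hy, doubleY]
  field_simp
  linear_combination (8 * y ^ 2 + 8 * x ^ 3 + 8 * β * x) * he

theorem tripleX_eq_doubleX_iff [NeZero (2 : L)] (he : y ^ 2 = x ^ 3 + β * x) (hy : y ≠ 0)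
    (h3 : divPolyThree β x ≠ 0) (h4 : doubleY β x y ≠ 0) :
    tripleX β x = doubleX β (doubleX β x y) (doubleY β x y) ↔ divPolySeven β x = 0 := by
  have h2 : (2 : L) ≠ 0 := two_ne_zero
  rw [tripleX, doubleX.eq_def β (doubleX β x y),
    div_eq_div_iff (pow_ne_zero 2 h3) (pow_ne_zero 2 (mul_ne_zero h2 h4))]
  have hdiff : x * (x ^ 4 - 6 * β * x ^ 2 - 3 * β ^ 2) ^ 2 * (2 * doubleY β x y) ^ 2
      - (doubleX β x y ^ 2 - β) ^ 2 * divPolyThree β x ^ 2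
      = divPolySeven β x / (2 * y) ^ 8 := by
    have hy4 : y ^ 4 = (x ^ 3 + β * x) ^ 2 := by rw [← he]; ring
    unfold divPolySeven doubleX doubleY divPolyThree
    field_simp
    rw [hy4, he]
    ring
  rw [← sub_eq_zero, hdiff, div_eq_zero_iff, or_iff_left (pow_ne_zero 8 (mul_ne_zero h2 hy))]

theorem Y_ne_zero_of_psiSeven [NeZero (2 : L)] (hβ : β ≠ 0) {u : L} (hu : x ^ 2 = β * u)
    (hψ : psiSeven u = 0) (he : y ^ 2 = x ^ 3 + β * x) : y ≠ 0 := by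
  have hx : x ≠ 0 := by
    rw [← pow_ne_zero_iff two_ne_zero, hu]
    exact mul_ne_zero hβ (ne_zero_of_psiSeven hψ)
  rw [← pow_ne_zero_iff two_ne_zero, he,
    show x ^ 3 + β * x = x * β * (u + 1) by linear_combination x * hu]
  exact mul_ne_zero (mul_ne_zero hx hβ) (add_one_ne_zero_of_psiSeven hψ)

variable {W : WeierstrassCurve.Affine L} [IsJ1728NF W]

theorem equation_iff_of_isJ1728NF : W.Equation x y ↔ y ^ 2 = x ^ 3 + W.a₄ * x := by
  simp [WeierstrassCurve.Affine.equation_iff, IsJ1728NF.a₆]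

theorem negY_of_isJ1728NF (x y : L) : W.negY x y = -y := by
  simp [WeierstrassCurve.Affine.negY]

theorem ne_negY_of_isJ1728NF [NeZero (2 : L)] (hy : y ≠ 0) : y ≠ W.negY x y := by
  rw [negY_of_isJ1728NF, Ne, eq_neg_iff_add_eq_zero, ← two_mul]
  exact mul_ne_zero two_ne_zero hy

theorem nonsingular_of_isJ1728NF [NeZero (2 : L)] (h : y ^ 2 = x ^ 3 + W.a₄ * x) (hy : y ≠ 0) :
    W.Nonsingular x y := by
  rw [WeierstrassCurve.Affine.nonsingular_iff']
  refine ⟨equation_iff_of_isJ1728NF.2 h, Or.inr ?_⟩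
  simpa using ⟨two_ne_zero (α := L), hy⟩

theorem addX_of_isJ1728NF (x₁ x₂ ℓ : L) : W.addX x₁ x₂ ℓ = ℓ ^ 2 - x₁ - x₂ := by
  simp [WeierstrassCurve.Affine.addX]

theorem addY_of_isJ1728NF (x₁ x₂ y₁ ℓ : L) :
    W.addY x₁ x₂ y₁ ℓ = -(ℓ * (W.addX x₁ x₂ ℓ - x₁) + y₁) := by
  rw [WeierstrassCurve.Affine.addY, negY_of_isJ1728NF, WeierstrassCurve.Affine.negAddY]

variable [DecidableEq L]

open WeierstrassCurve.Affine

theorem slope_self_of_isJ1728NF [NeZero (2 : L)] (hy : y ≠ 0) :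
    W.slope x x y y = (3 * x ^ 2 + W.a₄) / (2 * y) := by
  rw [slope_of_Y_ne rfl (ne_negY_of_isJ1728NF hy), negY_of_isJ1728NF]
  simp [two_mul]

theorem two_smul_some [NeZero (2 : L)] (h : W.Nonsingular x y) (hy : y ≠ 0) :
    ∃ h' : W.Nonsingular (doubleX W.a₄ x y) (doubleY W.a₄ x y),
      2 • Point.some x y h = Point.some _ _ h' := by
  have h2 : (2 : L) ≠ 0 := two_ne_zero
  have he := equation_iff_of_isJ1728NF.1 h.1
  have hX : W.addX x x (W.slope x x y y) = doubleX W.a₄ x y := by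
    rw [slope_self_of_isJ1728NF hy, addX_of_isJ1728NF, doubleX]
    field_simp
    linear_combination (-8 * x) * he
  have hY : W.addY x x y (W.slope x x y y) = doubleY W.a₄ x y := by
    rw [addY_of_isJ1728NF, hX, slope_self_of_isJ1728NF hy, doubleX, doubleY]
    field_simp
    linear_combination (-8 * y ^ 2 + 4 * x ^ 3 - 4 * W.a₄ * x) * he
  rw [← hX, ← hY, two_smul, Point.add_self_of_Y_ne (ne_negY_of_isJ1728NF hy)]
  exact ⟨_, rfl⟩

theorem three_smul_some [NeZero (2 : L)] (h : W.Nonsingular x y) (hy : y ≠ 0)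
    (h3 : divPolyThree W.a₄ x ≠ 0) :
    ∃ (Y : L) (h' : W.Nonsingular (tripleX W.a₄ x) Y),
      3 • Point.some x y h = Point.some _ _ h' := by
  have h2 : (2 : L) ≠ 0 := two_ne_zero
  have he := equation_iff_of_isJ1728NF.1 h.1
  obtain ⟨h', h2P⟩ := two_smul_some h hy
  have hX3 : W.addX (doubleX W.a₄ x y) x
      (W.slope (doubleX W.a₄ x y) x (doubleY W.a₄ x y) y) = tripleX W.a₄ x := by
    rw [slope_double W he hy h3, addX_of_isJ1728NF, tripleX, doubleX]
    field_simp
    rw [divPolyThree]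
    linear_combination (-4 * x * (3 * x ^ 4 + 6 * W.a₄ * x ^ 2 - W.a₄ ^ 2) ^ 2
      - 4 * x * (x ^ 4 - 6 * W.a₄ * x ^ 2 - 3 * W.a₄ ^ 2) ^ 2) * he
  rw [← hX3, succ_nsmul, h2P, Point.add_of_X_ne (doubleX_ne he hy h3)]
  exact ⟨_, _, rfl⟩

theorem seven_smul_eq_zero_iff [NeZero (2 : L)] (h : W.Nonsingular x y) (hy : y ≠ 0)
    (h3 : divPolyThree W.a₄ x ≠ 0) (h4 : doubleY W.a₄ x y ≠ 0) :
    7 • Point.some x y h = 0 ↔ divPolySeven W.a₄ x = 0 := by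
  obtain ⟨h₂, e₂⟩ := two_smul_some h hy
  obtain ⟨Y, h₃, e₃⟩ := three_smul_some h hy h3
  obtain ⟨h₄, e₄⟩ := two_smul_some h₂ h4
  have hne : 3 • Point.some x y h ≠ (2 * 2) • Point.some x y h := by
    rw [show 2 * 2 = 3 + 1 from rfl, add_nsmul _ 3 1, one_nsmul, Ne, left_eq_add]
    exact Point.some_ne_zero h
  rw [← tripleX_eq_doubleX_iff (equation_iff_of_isJ1728NF.1 h.1) hy h3 h4,
    Point.X_eq_iff (h₁ := h₃) (h₂ := h₄), ← e₄, ← e₃, ← e₂, smul_smul, or_iff_right hne,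
    eq_neg_iff_add_eq_zero, ← add_nsmul]
  rfl

theorem two_smul_of_Y_eq_zero (h : W.Nonsingular x y) (hy : y = 0) :
    2 • Point.some x y h = 0 := by
  rw [two_smul, Point.add_self_of_Y_eq]
  rw [negY_of_isJ1728NF, hy, neg_zero]

theorem three_smul_of_divPolyThree [NeZero (2 : L)] (h : W.Nonsingular x y) (hy : y ≠ 0)
    (h3 : divPolyThree W.a₄ x = 0) : 3 • Point.some x y h = 0 := by
  obtain ⟨h₂, e₂⟩ := two_smul_some h hy
  have hX := doubleX_sub (equation_iff_of_isJ1728NF.1 h.1) hy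
  rw [h3, neg_zero, zero_div, sub_eq_zero, Point.X_eq_iff (h₁ := h₂) (h₂ := h), ← e₂] at hX
  rw [succ_nsmul, ← eq_neg_iff_add_eq_zero]
  refine hX.resolve_left fun h1 => ?_
  simp [two_nsmul] at h1

theorem four_smul_of_doubleY [NeZero (2 : L)] (h : W.Nonsingular x y) (hy : y ≠ 0)
    (h4 : doubleY W.a₄ x y = 0) : 4 • Point.some x y h = 0 := by
  obtain ⟨h₂, e₂⟩ := two_smul_some h hy
  rw [show 4 = 2 * 2 from rfl, mul_nsmul, e₂, two_smul_of_Y_eq_zero h₂ h4]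

theorem divPolySeven_of_seven_smul [NeZero (2 : L)] (h : W.Nonsingular x y)
    (h7 : 7 • Point.some x y h = 0) : divPolySeven W.a₄ x = 0 := by
  have hcop {n : ℕ} (hn : Nat.Coprime n 7) : n • Point.some x y h ≠ 0 := fun hn0 =>
    Point.some_ne_zero h <| AddMonoid.addOrderOf_eq_one_iff.1 <|
      Nat.eq_one_of_dvd_coprimes hn (addOrderOf_dvd_of_nsmul_eq_zero hn0)
        (addOrderOf_dvd_of_nsmul_eq_zero h7)
  have hy : y ≠ 0 := fun hy => hcop (n := 2) (by norm_num) (two_smul_of_Y_eq_zero h hy)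
  exact (seven_smul_eq_zero_iff h hy
    (fun h3 => hcop (n := 3) (by norm_num) (three_smul_of_divPolyThree h hy h3))
    (fun h4 => hcop (n := 4) (by norm_num) (four_smul_of_doubleY h hy h4))).1 h7

theorem seven_smul_of_psiSeven [NeZero (2 : L)] (hβ : W.a₄ ≠ 0) {u : L} (hu : x ^ 2 = W.a₄ * u)
    (hψ : psiSeven u = 0) (h : W.Nonsingular x y) : 7 • Point.some x y h = 0 := by
  have hy := Y_ne_zero_of_psiSeven hβ hu hψ (equation_iff_of_isJ1728NF.1 h.1)
  have h3 : divPolyThree W.a₄ x ≠ 0 := by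
    rw [divPolyThree, show 3 * x ^ 4 + 6 * W.a₄ * x ^ 2 - W.a₄ ^ 2
      = W.a₄ ^ 2 * (3 * u ^ 2 + 6 * u - 1) by
        linear_combination (3 * (x ^ 2 + W.a₄ * u) + 6 * W.a₄) * hu]
    exact mul_ne_zero (pow_ne_zero 2 hβ) (psiThree_ne_zero_of_psiSeven hψ)
  have h4 : doubleY W.a₄ x y ≠ 0 := by
    rw [doubleY, show (x ^ 2 - W.a₄) * (x ^ 4 + 6 * W.a₄ * x ^ 2 + W.a₄ ^ 2)
      = W.a₄ ^ 3 * ((u - 1) * (u ^ 2 + 6 * u + 1)) by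
        rw [show x ^ 4 = (x ^ 2) ^ 2 by ring, hu]; ring]
    exact div_ne_zero (mul_ne_zero (pow_ne_zero 3 hβ) (mul_ne_zero
      (sub_one_ne_zero_of_psiSeven hψ) (psiFour_factor_ne_zero_of_psiSeven hψ)))
      (pow_ne_zero 3 (mul_ne_zero two_ne_zero hy))
  rw [seven_smul_eq_zero_iff h hy h3 h4, divPolySeven_eq hu, hψ, mul_zero]

end Points

section Torsion

open WeierstrassCurve.Affine

theorem finite_and_ncard_le_of_X_mem {L : Type*} [Field L] {W : WeierstrassCurve.Affine L}
    {A : Set W.Point} {S : Finset L} (hA : ∀ x y h, Point.some x y h ∈ A → x ∈ S) :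
    A.Finite ∧ A.ncard ≤ S.card * 2 + 1 := by
  classical
  have hfiber (x : L) : ∃ T : Finset W.Point, T.card ≤ 2 ∧ ∀ y h, Point.some x y h ∈ T := by
    by_cases hx : ∃ y, W.Nonsingular x y
    · obtain ⟨y, h⟩ := hx
      refine ⟨{.some x y h, -.some x y h}, Finset.card_le_two, fun y' h' => ?_⟩
      simpa only [Finset.mem_insert, Finset.mem_singleton] using Point.X_eq_iff.1 rfl
    · exact ⟨∅, by simp, fun y h => (hx ⟨y, h⟩).elim⟩
  choose T hT hmem using hfiber
  have hsub : A ⊆ (insert 0 (S.biUnion T) : Finset W.Point) := by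
    rintro (_ | ⟨x, y, h⟩) hP
    · exact Finset.mem_insert_self _ _
    · exact Finset.mem_insert_of_mem (Finset.mem_biUnion.2 ⟨x, hA x y h hP, hmem x y h⟩)
  refine ⟨(Finset.finite_toSet _).subset hsub, ?_⟩
  refine (Set.ncard_le_ncard hsub (Finset.finite_toSet _)).trans ?_
  rw [Set.ncard_coe_finset]
  exact (Finset.card_insert_le _ _).trans
    (Nat.succ_le_succ (Finset.card_biUnion_le_card_mul _ _ _ fun x _ => hT x))

variable {L : Type*} [Field L] {W : WeierstrassCurve.Affine L} [IsJ1728NF W]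

theorem nonsingular_mulI {i x y : L} (hi : i ^ 2 = -1) (h : W.Nonsingular x y) :
    W.Nonsingular (-x) (i * y) := by
  have hi0 : i ≠ 0 := by rintro rfl; simp at hi
  rw [WeierstrassCurve.Affine.nonsingular_iff', equation_iff_of_isJ1728NF] at h ⊢
  refine ⟨by linear_combination i ^ 2 * h.1 + (x ^ 3 + W.a₄ * x) * hi, ?_⟩
  simpa [hi0] using h.2

variable [DecidableEq L]

open Polynomial in
theorem finite_seven_torsion [NeZero (2 : L)] (h7 : (7 : L) ≠ 0) :
    {P : W.Point | 7 • P = 0}.Finite ∧ {P : W.Point | 7 • P = 0}.ncard ≤ 7 ^ 2 := by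
  let p : L[X] := divPolySeven (C W.a₄) X
  have hdeg : p.natDegree = 24 := by
    simp only [p, divPolySeven]
    compute_degree!
  have hp0 : p ≠ 0 := ne_zero_of_natDegree_gt (n := 0) (by omega)
  have hroot : ∀ x y (h : W.Nonsingular x y), Point.some x y h ∈ {P : W.Point | 7 • P = 0} →
      x ∈ p.roots.toFinset := by
    intro x y h hP
    rw [Multiset.mem_toFinset, mem_roots hp0, IsRoot]
    simpa [p, divPolySeven] using divPolySeven_of_seven_smul h hP
  have hcard : p.roots.toFinset.card ≤ 24 :=
    (Multiset.toFinset_card_le _).trans ((card_roots' p).trans hdeg.le)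
  obtain ⟨hfin, hle⟩ := finite_and_ncard_le_of_X_mem hroot
  exact ⟨hfin, by omega⟩

theorem slope_mulI {i x₁ x₂ y₁ y₂ : L} (hi : i ^ 2 = -1)
    (hxy : ¬(x₁ = x₂ ∧ y₁ = W.negY x₂ y₂)) :
    W.slope (-x₁) (-x₂) (i * y₁) (i * y₂) = -i * W.slope x₁ x₂ y₁ y₂ := by
  have hi0 : i ≠ 0 := by rintro rfl; simp at hi
  have hinv : i⁻¹ = -i := inv_eq_of_mul_eq_one_right (by linear_combination -hi)
  by_cases hx : x₁ = x₂
  · have hy : y₁ ≠ W.negY x₂ y₂ := fun hy => hxy ⟨hx, hy⟩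
    have hy' : i * y₁ ≠ W.negY (-x₂) (i * y₂) := by
      rwa [negY_of_isJ1728NF, ← mul_neg, Ne, mul_right_inj' hi0, ← negY_of_isJ1728NF (W := W) x₂]
    rw [slope_of_Y_ne hx hy, slope_of_Y_ne (by rw [hx]) hy', negY_of_isJ1728NF,
      negY_of_isJ1728NF, ← mul_neg, ← mul_sub, div_eq_mul_inv, mul_inv, hinv]
    simp only [WeierstrassCurve.IsShortNF.a₁, WeierstrassCurve.IsShortNF.a₂]
    ring
  · rw [slope_of_X_ne hx, slope_of_X_ne (by simpa using hx), ← mul_sub,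
      show -x₁ - -x₂ = -(x₁ - x₂) by ring, div_neg, mul_div_assoc, neg_mul]

/-- Multiplication by `i` on `y² = x³ + a₄ x`, that is, the endomorphism `(x, y) ↦ (-x, i y)`. -/
def mulI {i : L} (hi : i ^ 2 = -1) : W.Point →+ W.Point where
  toFun
    | .zero => .zero
    | .some x y h => .some (-x) (i * y) (nonsingular_mulI hi h)
  map_zero' := rfl
  map_add' := by
    rintro (_ | ⟨x₁, y₁, h₁⟩) (_ | ⟨x₂, y₂, h₂⟩)
    any_goals rfl
    by_cases hxy : x₁ = x₂ ∧ y₁ = W.negY x₂ y₂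
    · rw [Point.add_of_Y_eq hxy.1 hxy.2]
      exact (Point.add_of_Y_eq (by rw [hxy.1])
        (by rw [hxy.2, negY_of_isJ1728NF, negY_of_isJ1728NF, mul_neg])).symm
    · have hi0 : i ≠ 0 := by rintro rfl; simp at hi
      have hxy' : ¬(-x₁ = -x₂ ∧ i * y₁ = W.negY (-x₂) (i * y₂)) := by
        rwa [negY_of_isJ1728NF, ← mul_neg, neg_inj, mul_right_inj' hi0,
          ← negY_of_isJ1728NF (W := W) x₂]
      rw [Point.add_some hxy]
      dsimp only
      rw [Point.add_some hxy']
      simp only [Point.some.injEq, slope_mulI hi hxy, addY_of_isJ1728NF, addX_of_isJ1728NF]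
      generalize W.slope x₁ x₂ y₁ y₂ = ℓ
      exact ⟨by linear_combination (-ℓ ^ 2) * hi, by linear_combination (-i * ℓ ^ 3) * hi⟩

theorem mulI_some {i x y : L} (hi : i ^ 2 = -1) (h : W.Nonsingular x y) :
    mulI hi (.some x y h) = .some (-x) (i * y) (nonsingular_mulI hi h) := rfl

theorem mulI_mulI {i : L} (hi : i ^ 2 = -1) (P : W.Point) : mulI hi (mulI hi P) = -P := by
  rcases P with _ | ⟨x, y, h⟩
  · rfl
  · simp only [mulI_some, Point.neg_some, Point.some.injEq, neg_neg, negY_of_isJ1728NF, true_and]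
    linear_combination y * hi

theorem map_mulI {R M M' : Type*} [Field R] [Field M] [Field M'] [DecidableEq M] [DecidableEq M']
    [Algebra R M] [Algebra R M'] {W : WeierstrassCurve R} [IsJ1728NF W] (f : M →ₐ[R] M') {i : M}
    {i' : M'} (hi : i ^ 2 = -1) (hi' : i' ^ 2 = -1) (hf : f i = i')
    (Q : (W.baseChange M).toAffine.Point) :
    Point.map (W' := W) f (mulI hi Q) = mulI hi' (Point.map f Q) := by
  subst hf
  rcases Q with _ | ⟨x, y, h⟩
  · rfl
  · simp only [mulI_some, Point.map_some, map_neg, map_mul]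

theorem mem_of_some_mem_range_map {K M : Type*} [Field K] [Field M] [DecidableEq M] [Algebra K M]
    {W : WeierstrassCurve K} {F : IntermediateField K M} {x y : M}
    {h : (W.baseChange M).toAffine.Nonsingular x y}
    (hP : Point.some x y h ∈ (Point.map (W' := W) F.val).range) : x ∈ F ∧ y ∈ F := by
  obtain ⟨_ | ⟨x', y', h'⟩, e⟩ := hP
  · cases e
  · rw [Point.map_some, Point.some.injEq] at e
    exact ⟨e.1 ▸ x'.2, e.2 ▸ y'.2⟩

theorem some_mem_range_map {K M : Type*} [Field K] [Field M] [DecidableEq M] [Algebra K M]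
    {W : WeierstrassCurve K} {F : IntermediateField K M} {x y : M} (hx : x ∈ F) (hy : y ∈ F)
    (h : (W.baseChange M).toAffine.Nonsingular x y) :
    Point.some x y h ∈ (Point.map (W' := W) F.val).range :=
  ⟨.some ⟨x, hx⟩ ⟨y, hy⟩ ((baseChange_nonsingular W F.val.injective ⟨x, hx⟩ ⟨y, hy⟩).1 h), rfl⟩

theorem dvd_and_dvd_of_dvd_sq_add_sq {p : ℕ} [Fact p.Prime] (hp : p % 4 = 3) {a c : ℤ}
    (h : (p : ℤ) ∣ a ^ 2 + c ^ 2) : (p : ℤ) ∣ a ∧ (p : ℤ) ∣ c := by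
  simp only [← ZMod.intCast_zmod_eq_zero_iff_dvd, Int.cast_add, Int.cast_pow] at h ⊢
  have hc : (c : ZMod p) = 0 := by
    by_contra hc
    exact ZMod.mod_four_ne_three_of_sq_eq_neg_sq' hc (eq_neg_of_add_eq_zero_left h) hp
  rw [hc, zero_pow two_ne_zero, add_zero] at h
  exact ⟨pow_eq_zero_iff two_ne_zero |>.1 h, hc⟩

section Gaussian

variable {G : Type*} [AddCommGroup G] {p : ℕ} [Fact p.Prime] {J : G →+ G} {P : G}

-- Applying `a - c J` to the relation turns it into `(a² + c²) • P = 0`.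
theorem dvd_and_dvd_of_zsmul_add_zsmul_eq_zero (hp : p % 4 = 3) (hJ : ∀ Q, J (J Q) = -Q)
    (hord : addOrderOf P = p) {a c : ℤ} (h : a • P + c • J P = 0) :
    (p : ℤ) ∣ a ∧ (p : ℤ) ∣ c := by
  refine dvd_and_dvd_of_dvd_sq_add_sq hp ?_
  rw [← hord, addOrderOf_dvd_iff_zsmul_eq_zero]
  calc (a ^ 2 + c ^ 2) • P = a • (a • P + c • J P) - c • J (a • P + c • J P) := by
        rw [map_add, map_zsmul, map_zsmul, hJ]; module
    _ = 0 := by rw [h, map_zero, smul_zero, smul_zero, sub_zero]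

theorem exists_eq_nsmul_add_nsmul (hp : p % 4 = 3) (hJ : ∀ Q, J (J Q) = -Q)
    (hfin : {Q : G | p • Q = 0}.Finite) (hcard : {Q : G | p • Q = 0}.ncard ≤ p ^ 2)
    (hP : P ≠ 0) (hpP : p • P = 0) {Q : G} (hQ : p • Q = 0) : ∃ m n : ℕ, Q = m • P + n • J P := by
  let f : Fin p × Fin p → G := fun m => (m.1 : ℕ) • P + (m.2 : ℕ) • J P
  have hf : Function.Injective f := by
    rintro ⟨m, n⟩ ⟨m', n'⟩ e
    have e' : ((m : ℤ) - m') • P + ((n : ℤ) - n') • J P = 0 := by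
      simp only [sub_smul, natCast_zsmul]
      rw [sub_add_sub_comm]
      exact sub_eq_zero.2 e
    obtain ⟨hm, hn⟩ :=
      dvd_and_dvd_of_zsmul_add_zsmul_eq_zero hp hJ (addOrderOf_eq_prime hpP hP) e'
    have key (k l : Fin p) (h : (p : ℤ) ∣ (k : ℤ) - l) : k = l :=
      Fin.ext (Nat.ModEq.eq_of_lt_of_lt ((Int.natCast_modEq_iff.1 (Int.modEq_of_dvd h)).symm)
        k.2 l.2)
    exact Prod.ext (key m m' hm) (key n n' hn)
  have hsub : Set.range f ⊆ {Q : G | p • Q = 0} := by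
    rintro _ ⟨⟨m, n⟩, rfl⟩
    rw [Set.mem_ofPred_eq, smul_add, smul_comm p, smul_comm p, ← map_nsmul J p P, hpP, map_zero,
      smul_zero, smul_zero, add_zero]
  have hrange : (Set.range f).ncard = p ^ 2 := by
    rw [← Set.image_univ, Set.ncard_image_of_injective _ hf, Set.ncard_univ]
    simp [sq]
  have heq := Set.eq_of_subset_of_ncard_le hsub (by rwa [hrange]) hfin
  obtain ⟨⟨m, n⟩, h⟩ := heq.symm ▸ (show Q ∈ {Q : G | p • Q = 0} from hQ)
  exact ⟨m, n, h.symm⟩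

theorem map_map_comm_of_map_comm (hp : p % 4 = 3) (hJ : ∀ Q, J (J Q) = -Q)
    (hfin : {Q : G | p • Q = 0}.Finite) (hcard : {Q : G | p • Q = 0}.ncard ≤ p ^ 2)
    (hP : P ≠ 0) (hpP : p • P = 0) {φ ψ : G →+ G} (hφ : ∀ Q, φ (J Q) = J (φ Q))
    (hψ : ∀ Q, ψ (J Q) = J (ψ Q)) : φ (ψ P) = ψ (φ P) := by
  have hgen (f : G →+ G) := exists_eq_nsmul_add_nsmul (Q := f P) hp hJ hfin hcard hP hpP
    (by rw [← map_nsmul, hpP, map_zero])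
  obtain ⟨m, n, hm⟩ := hgen φ
  obtain ⟨k, l, hk⟩ := hgen ψ
  rw [hm, hk]
  simp only [map_add, map_nsmul, hφ, hψ, hm, hk, hJ]
  module

end Gaussian

end Torsion

section Tower

open IntermediateField Polynomial

theorem minpoly_eq_of_natDegree_le_three {F L : Type*} [Field F] [Field L] [Algebra F L] {z : L}
    {p : F[X]} (hp : p.Monic) (hp₂ : 2 ≤ p.natDegree) (hp₃ : p.natDegree ≤ 3)
    (hroot : ∀ a, ¬p.IsRoot a) (hz : aeval z p = 0) : minpoly F z = p := by
  refine (minpoly.eq_of_irreducible_of_monic ?_ hz hp).symm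
  rw [hp.irreducible_iff_roots_eq_zero_of_degree_le_three hp₂ hp₃,
    Multiset.eq_zero_iff_forall_notMem]
  exact fun a ha => hroot a (isRoot_of_mem_roots ha)

variable {K L : Type*} [Field K] [Field L] [Algebra K L] {F : IntermediateField K L}

open scoped Classical in
theorem finrank_sup_adjoin_simple {z : L} {p : F[X]} (hp : p.Monic) (hp₂ : 2 ≤ p.natDegree)
    (hp₃ : p.natDegree ≤ 3) (hroot : ∀ a, p.IsRoot a → z ∈ F) (hz : aeval z p = 0) :
    Module.finrank K ↥(F ⊔ K⟮z⟯) = Module.finrank K F * if z ∉ F then p.natDegree else 1 := by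
  split_ifs with h
  · rw [sup_eq_left.2 (adjoin_simple_le_iff.2 h), mul_one]
  · have hmin := minpoly_eq_of_natDegree_le_three hp hp₂ hp₃ (fun a ha => h (hroot a ha)) hz
    rw [← restrictScalars_adjoin_eq_sup, ← hmin, ← adjoin.finrank ⟨p, hp, hz⟩]
    exact (Module.finrank_mul_finrank K F F⟮z⟯).symm

open scoped Classical in
theorem finrank_sup_sqrt {r : L} (hr : r ^ 2 ∈ F) :
    Module.finrank K ↥(F ⊔ K⟮r⟯) = Module.finrank K F * if r ∉ F then 2 else 1 := by
  lift r ^ 2 to F using hr with c hc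
  have hdeg : (X ^ 2 - C c).natDegree = 2 := natDegree_X_pow_sub_C
  rw [finrank_sup_adjoin_simple (monic_X_pow_sub_C c two_ne_zero) hdeg.ge (by omega) ?_ ?_, hdeg]
  · intro a ha
    have ha' : a ^ 2 = c := by simpa [sub_eq_zero] using ha
    rw [← ha', IntermediateField.coe_pow, eq_comm, sq_eq_sq_iff_eq_or_eq_neg] at hc
    rcases hc with h | h
    · exact h ▸ a.2
    · exact h ▸ neg_mem a.2
  · rw [map_sub, map_pow, aeval_X, aeval_C, IntermediateField.algebraMap_apply, hc, sub_self]

-- The roots of the cubic polynomial are permuted cyclically by `z ↦ z ^ 2 - 2`.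
theorem mem_of_cubic_root {z : L} (hz : z ^ 3 + z ^ 2 - 2 * z - 1 = 0) {a : F}
    (ha : a ^ 3 + a ^ 2 - 2 * a - 1 = 0) : z ∈ F := by
  have ha' : (a ^ 3 + a ^ 2 - 2 * a - 1 : L) = 0 := congrArg Subtype.val ha
  have hprod : (z - a) * ((z - (a ^ 2 - 2)) * (z - ((a ^ 2 - 2) ^ 2 - 2))) = 0 := by
    linear_combination hz + (-1 + z ^ 2 - z ^ 2 * a + 2 * z + z * a ^ 3 - 4 * z * a - a ^ 4
      + a ^ 3 + 3 * a ^ 2 - 2 * a : L) * ha'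
  have hmem {c : L} (e : z - c = 0) (hc : c ∈ F) : z ∈ F := by rwa [sub_eq_zero.1 e]
  rcases mul_eq_zero.1 hprod with e | e
  · exact hmem e a.2
  rcases mul_eq_zero.1 e with e | e
  · exact hmem e (a ^ 2 - 2).2
  · exact hmem e ((a ^ 2 - 2) ^ 2 - 2).2

/-- The minimal polynomial of `ζ + ζ⁻¹` over `ℚ`, over an arbitrary ring of coefficients. -/
noncomputable def cosPoly (R : Type*) [CommRing R] : R[X] := X ^ 3 + X ^ 2 - 2 * X - 1

theorem natDegree_cosPoly {R : Type*} [CommRing R] [Nontrivial R] :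
    (cosPoly R).natDegree = 3 := by
  unfold cosPoly
  compute_degree!

theorem monic_cosPoly {R : Type*} [CommRing R] : (cosPoly R).Monic := by
  unfold cosPoly
  monicity!

theorem mem_of_isRoot_cosPoly {z : L} (hz : z ^ 3 + z ^ 2 - 2 * z - 1 = 0) {a : F}
    (ha : (cosPoly F).IsRoot a) : z ∈ F :=
  mem_of_cubic_root hz (by simpa [cosPoly] using ha)

theorem aeval_cosPoly {z : L} (hz : z ^ 3 + z ^ 2 - 2 * z - 1 = 0) :
    aeval z (cosPoly F) = 0 := by
  simpa only [cosPoly, map_sub, map_add, map_mul, map_pow, map_ofNat, map_one, aeval_X] using hz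

open scoped Classical in
theorem finrank_sup_cubic {z : L} (hz : z ^ 3 + z ^ 2 - 2 * z - 1 = 0) :
    Module.finrank K ↥(F ⊔ K⟮z⟯) = Module.finrank K F * if z ∉ F then 3 else 1 := by
  rw [finrank_sup_adjoin_simple monic_cosPoly
    (by rw [natDegree_cosPoly]; norm_num) natDegree_cosPoly.le
    (fun _ => mem_of_isRoot_cosPoly hz) (aeval_cosPoly hz), natDegree_cosPoly]

theorem mem_of_cubic_of_quadratic {z : L} (hz : z ^ 3 + z ^ 2 - 2 * z - 1 = 0) {a b c : F}
    (h : a + b * z + c * z ^ 2 = 0) (hac : a ≠ 0 ∨ c ≠ 0) : z ∈ F := by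
  by_contra hzF
  have hmin := minpoly_eq_of_natDegree_le_three monic_cosPoly (by rw [natDegree_cosPoly]; norm_num)
    natDegree_cosPoly.le (fun _ ha => hzF (mem_of_isRoot_cosPoly hz ha)) (aeval_cosPoly hz)
  have hq : C c * X ^ 2 + C b * X + C a = 0 := by
    refine eq_zero_of_dvd_of_natDegree_lt (minpoly.dvd F z ?_) ?_
    · simp only [map_add, map_mul, map_pow, aeval_C, aeval_X, IntermediateField.algebraMap_apply]
      linear_combination h
    · rw [hmin, natDegree_cosPoly]
      exact natDegree_quadratic_le.trans_lt (by norm_num)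
  have ha : a = 0 := by simpa using congrArg (coeff · 0) hq
  have hc : c = 0 := by simpa using congrArg (coeff · 2) hq
  exact hac.elim (· ha) (· hc)

theorem exists_eq_add_mul_of_mem_sup {r t : L} (hr : r ^ 2 ∈ F) (ht : t ∈ F ⊔ K⟮r⟯) :
    ∃ α β : F, t = α + β * r := by
  lift r ^ 2 to F using hr with c hc
  have hint : IsIntegral F r :=
    ⟨X ^ 2 - C c, monic_X_pow_sub_C c two_ne_zero, by
      simp [← hc, IntermediateField.algebraMap_apply]⟩
  rw [← restrictScalars_adjoin_eq_sup, mem_restrictScalars, ← mem_toSubalgebra,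
    adjoin_simple_toSubalgebra_of_isAlgebraic hint.isAlgebraic] at ht
  induction ht using Algebra.adjoin_induction with
  | mem x hx => exact ⟨0, 1, by simpa using hx⟩
  | algebraMap a => exact ⟨a, 0, by simp [IntermediateField.algebraMap_apply]⟩
  | add x y _ _ hx hy =>
    obtain ⟨α, β, rfl⟩ := hx
    obtain ⟨γ, δ, rfl⟩ := hy
    exact ⟨α + γ, β + δ, by push_cast; ring⟩
  | mul x y _ _ hx hy =>
    obtain ⟨α, β, rfl⟩ := hx
    obtain ⟨γ, δ, rfl⟩ := hy
    exact ⟨α * γ + β * δ * c, α * δ + β * γ, by push_cast; linear_combination (-β * δ : L) * hc⟩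

-- If `r ∉ F`, then `p ^ 2 - q ^ 2 * c` is the norm of `t ^ 2`, so a square in `F`, and so is `c`.
theorem mem_of_sqrt_mem_sup {r t : L} {c p q w : F} (hr : r ^ 2 = c) (ht : t ∈ F ⊔ K⟮r⟯)
    (htr : t ^ 2 = p + q * r) (hnorm : (p ^ 2 - q ^ 2 * c) * c = w ^ 2) (hw : w ≠ 0) : r ∈ F := by
  obtain ⟨α, β, rfl⟩ := exists_eq_add_mul_of_mem_sup (hr ▸ c.2) ht
  by_contra hrF
  have hlin : (α ^ 2 + β ^ 2 * c - p : L) = (q - 2 * α * β) * r := by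
    linear_combination htr - (β ^ 2 : L) * hr
  have hq : (q - 2 * α * β : L) = 0 := by
    by_contra h
    refine hrF ?_
    rw [← mul_div_cancel_left₀ r h, ← hlin]
    exact ((α ^ 2 + β ^ 2 * c - p) / (q - 2 * α * β)).2
  rw [hq, zero_mul] at hlin
  have hsq : ((α ^ 2 - β ^ 2 * c) * r : L) ^ 2 = (w : L) ^ 2 := by
    have hnorm' : ((p ^ 2 - q ^ 2 * c) * c : L) = w ^ 2 := mod_cast hnorm
    rw [← hnorm', sub_eq_zero.1 hq, ← sub_eq_zero.1 hlin, mul_pow, hr]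
    ring
  have hr_eq : r = w / (α ^ 2 - β ^ 2 * c) ∨ r = -w / (α ^ 2 - β ^ 2 * c) := by
    have h0 : (α ^ 2 - β ^ 2 * c : L) ≠ 0 := by
      intro h0
      rw [h0, zero_mul, zero_pow two_ne_zero, eq_comm, sq_eq_zero_iff] at hsq
      exact hw (mod_cast hsq)
    rwa [eq_div_iff h0, eq_div_iff h0, mul_comm r, ← sq_eq_sq_iff_eq_or_eq_neg]
  rcases hr_eq with h | h
  · exact hrF (h ▸ (w / (α ^ 2 - β ^ 2 * c)).2)
  · exact hrF (h ▸ (-w / (α ^ 2 - β ^ 2 * c)).2)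

end Tower

section Table

open Cond

/-- The degree of the step attached to a condition in the tower
`K ⊆ K(i) ⊆ K(i, ζ + ζ⁻¹) ⊆ K(i, ζ) ⊆ K(i, ζ, s) ⊆ K(i, ζ, x₁) ⊆ K(i, ζ, x₁, y₁)`, provided that the
condition holds; otherwise the step is trivial. -/
def Cond.stepDegree : Cond → ℕ
  | .B1 => 3
  | _ => 2

/-- The degree over `K` of the top of the tower, if `T` is the set of conditions that hold. -/
def towerDegree (T : Finset Cond) : ℕ := ∏ c ∈ T, c.stepDegree

/-- The implications `B2 → C → D → E` between the conditions. -/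
def IsAdmissible (T : Finset Cond) : Prop :=
  (B2 ∈ T → C ∈ T) ∧ (C ∈ T → D ∈ T) ∧ (D ∈ T → E ∈ T)

instance : DecidablePred IsAdmissible := fun T => by unfold IsAdmissible; infer_instance

theorem Table.eq_towerDegree {d : ℕ} {T : Finset Cond} (h : Table d T) : d = towerDegree T := by
  cases h with
  | deg96 | deg32 | deg24 | deg4 | deg3 | deg1 => decide
  | deg48 S hS h | deg16 S hS h | deg8 S hS h => revert S; decide
  | deg24' p q hp hq => revert p q; decide
  | deg12 p hp | deg6 p hp | deg4' p hp | deg2 p hp => revert p; decide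

theorem IsAdmissible.eq_or : ∀ T : Finset Cond, IsAdmissible T →
    T = {A, B1, B2, C, D, E} ∨ T = {B1, E} ∪ {A, C, D} ∨ T = {B1, E, A, D} ∨ T = {B1, E, A} ∨
    T = {B1, A} ∨ T = {B1, E} ∪ {B2, C, D} ∨ T = {B1, E, C, D} ∨ T = {B1, E, D} ∨ T = {B1, E} ∨
    T = {B1} ∨ T = {A, B2, C, D, E} ∨ T = {E} ∪ {A, C, D} ∨ T = {E} ∪ {A, D} ∨ T = {E, A} ∨
    T = {A} ∨ T = {E} ∪ {B2, C, D} ∨ T = {E} ∪ {C, D} ∨ T = {E, D} ∨ T = {E} ∨ T = ∅ := by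
  decide

theorem IsAdmissible.table {T : Finset Cond} (h : IsAdmissible T) : Table (towerDegree T) T := by
  rcases h.eq_or with rfl | rfl | rfl | rfl | rfl | rfl | rfl | rfl | rfl | rfl | rfl | rfl |
    rfl | rfl | rfl | rfl | rfl | rfl | rfl | rfl
  · exact .deg96
  · exact .deg48 {A, C, D} (by decide) (by decide)
  · exact .deg24' A D (by decide) (by decide)
  · exact .deg12 A (by decide)
  · exact .deg6 A (by decide)
  · exact .deg48 {B2, C, D} (by decide) (by decide)
  · exact .deg24
  · exact .deg12 D (by decide)
  · exact .deg6 E (by decide)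
  · exact .deg3
  · exact .deg32
  · exact .deg16 {A, C, D} (by decide) (by decide)
  · exact .deg8 {A, D} (by decide) (by decide)
  · exact .deg4' A (by decide)
  · exact .deg2 A (by decide)
  · exact .deg16 {B2, C, D} (by decide) (by decide)
  · exact .deg8 {C, D} (by decide) (by decide)
  · exact .deg4' D (by decide)
  · exact .deg2 E (by decide)
  · exact .deg1

theorem IsAdmissible.towerDegree_eq_iff {T : Finset Cond} (h : IsAdmissible T) {d : ℕ} :
    towerDegree T = d ↔ Table d T :=
  ⟨fun e => e ▸ h.table, fun ht => ht.eq_towerDegree.symm⟩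

theorem IsAdmissible.towerDegree_mem : ∀ {T : Finset Cond}, IsAdmissible T →
    towerDegree T ∈ degrees := by
  decide

open scoped Classical in
theorem towerDegree_holding {K L : Type*} [Field K] [Field L] [Algebra K L] (i ζ s x y : L) :
    towerDegree (holding K i ζ s x y)
      = (if A.Holds K i ζ s x y then 2 else 1) * (if B1.Holds K i ζ s x y then 3 else 1)
        * (if B2.Holds K i ζ s x y then 2 else 1) * (if C.Holds K i ζ s x y then 2 else 1)
        * (if D.Holds K i ζ s x y then 2 else 1) * (if E.Holds K i ζ s x y then 2 else 1) := by
  have hprod (f : Cond → ℕ) : ∏ c, f c = f A * f B1 * f B2 * f C * f D * f E := by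
    change f A * (f B1 * (f B2 * (f C * (f D * (f E * 1))))) = _
    ring
  rw [towerDegree, holding, Finset.prod_filter, hprod]
  rfl

end Table

section Data

open IntermediateField WeierstrassCurve.Affine

variable {K L L' : Type*} [Field K] [Field L] [Field L'] [Algebra K L] [Algebra K L']
  {F : IntermediateField K L} {b : K} {i ζ s x y : L}

theorem map_omegaOne (σ : L →ₐ[K] L') (i ζ : L) : σ (omegaOne i ζ) = omegaOne (σ i) (σ ζ) := by
  simp [omegaOne, map_ofNat]

theorem map_thetaOne (σ : L →ₐ[K] L') (i ζ : L) : σ (thetaOne i ζ) = thetaOne (σ i) (σ ζ) := by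
  simp [thetaOne, map_ofNat]

theorem omegaOne_mem (hi : i ∈ F) (hζ : ζ ∈ F) : omegaOne i ζ ∈ F := by
  lift i to F using hi
  lift ζ to F using hζ
  exact map_omegaOne F.val i ζ ▸ (omegaOne i ζ).2

theorem thetaOne_mem (hi : i ∈ F) (hζ : ζ ∈ F) : thetaOne i ζ ∈ F := by
  lift i to F using hi
  lift ζ to F using hζ
  exact map_thetaOne F.val i ζ ▸ (thetaOne i ζ).2

theorem sinGen_mem (hi : i ∈ F) (hζ : ζ ∈ F) : sinGen i ζ ∈ F :=
  mul_mem hi (sub_mem hζ (pow_mem hζ 6))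

theorem neZero_two [NeZero (2 : L)] (F : IntermediateField K L) : NeZero (2 : F) :=
  ⟨fun h => two_ne_zero (α := L) (congrArg Subtype.val h)⟩

/-- The hypotheses on the numbers `i`, `ζ₇`, `√θ₁`, `x₁`, `y₁`. -/
structure IsSevenData (b : K) (i ζ s x y : L) : Prop where
  b_ne : b ≠ 0
  i_sq : i ^ 2 = -1
  prim : IsPrimitiveRoot ζ 7
  s_sq : s ^ 2 = thetaOne i ζ
  x_sq : x ^ 2 = omegaOne i ζ * algebraMap K L b + 1 / 2 * algebraMap K L b * s
  y_sq : y ^ 2 = (omegaOne i ζ + 1 / 2 * s + 1) * algebraMap K L b * x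

namespace IsSevenData

theorem i_ne (h : IsSevenData b i ζ s x y) : i ≠ 0 := by
  rintro rfl
  simpa using h.i_sq

theorem algebraMap_ne (h : IsSevenData b i ζ s x y) : algebraMap K L b ≠ 0 := by
  simpa using h.b_ne

theorem x_sq_eq (h : IsSevenData b i ζ s x y) :
    x ^ 2 = algebraMap K L b * (omegaOne i ζ + 1 / 2 * s) := by
  linear_combination h.x_sq

theorem equation (h : IsSevenData b i ζ s x y) : y ^ 2 = x ^ 3 + algebraMap K L b * x := by
  linear_combination h.y_sq - x * h.x_sq

variable [NeZero (2 : L)]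

theorem isSevenTriple (h : IsSevenData b i ζ s x y) :
    IsSevenTriple (cosGen ζ) (sinGen i ζ) (omegaOne i ζ + 1 / 2 * s) := by
  refine .of_four_mul_sq (cosGen_cubic h.prim) (sinGen_sq h.i_sq h.prim) ?_
  rw [← sinGen_mul_thetaOne h.i_sq h.prim, ← omegaOne_eq h.prim, ← h.s_sq]
  field_simp
  ring

theorem psiSeven_eq_zero (h : IsSevenData b i ζ s x y) : psiSeven (omegaOne i ζ + 1 / 2 * s) = 0 :=
  h.isSevenTriple.psiSeven_eq_zero

theorem y_ne (h : IsSevenData b i ζ s x y) : y ≠ 0 :=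
  Y_ne_zero_of_psiSeven h.algebraMap_ne h.x_sq_eq h.psiSeven_eq_zero h.equation

theorem nonsingular (h : IsSevenData b i ζ s x y) :
    ((curve b).baseChange L).toAffine.Nonsingular x y :=
  nonsingular_of_isJ1728NF h.equation h.y_ne

theorem seven_smul [DecidableEq L] (h : IsSevenData b i ζ s x y) :
    7 • Point.some x y h.nonsingular = 0 :=
  seven_smul_of_psiSeven h.algebraMap_ne h.x_sq_eq h.psiSeven_eq_zero _

theorem zeta_mem (h : IsSevenData b i ζ s x y) (hi : i ∈ F) (ht : cosGen ζ ∈ F)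
    (hρ : sinGen i ζ ∈ F) : ζ ∈ F := by
  have hζ : ζ = ((cosGen ζ ^ 2 - 2) ^ 2 - 2 - i * sinGen i ζ) / 2 := by
    rw [← two_mul_zeta_eq h.i_sq h.prim, mul_div_cancel_left₀ ζ two_ne_zero]
  rw [hζ]
  lift i to F using hi
  lift cosGen ζ to F using ht with t
  lift sinGen (i : L) ζ to F using hρ with ρ
  exact (((t ^ 2 - 2) ^ 2 - 2 - i * ρ) / 2).2

theorem s_mem (h : IsSevenData b i ζ s x y) (hi : i ∈ F) (hζ : ζ ∈ F) (hx : x ∈ F) : s ∈ F := by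
  have hs : s = 2 * (x ^ 2 / algebraMap K L b - omegaOne i ζ) := by
    rw [h.x_sq_eq, mul_div_cancel_left₀ _ h.algebraMap_ne]
    field_simp
    ring
  rw [hs]
  exact mul_mem (ofNat_mem F 2)
    (sub_mem (div_mem (pow_mem hx 2) (F.algebraMap_mem b)) (omegaOne_mem hi hζ))

theorem zeta_mem_of_s_mem_sup (h : IsSevenData b i ζ s x y) (hi : i ∈ F) (ht : cosGen ζ ∈ F)
    (hs : s ∈ F ⊔ K⟮sinGen i ζ⟯) : ζ ∈ F := by
  refine h.zeta_mem hi ht ?_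
  have hcub := cosGen_cubic h.prim
  have hρ := sinGen_sq h.i_sq h.prim
  have hρ0 := ne_zero_of_sq_eq_two_sub (seven_ne_zero_of_isPrimitiveRoot h.prim) hcub hρ
  have hθ := sinGen_mul_thetaOne h.i_sq h.prim
  have hi2 := h.i_sq
  have hi0 := h.i_ne
  rw [← h.s_sq] at hθ
  generalize sinGen i ζ = ρ at hρ hρ0 hθ hs ⊢
  generalize cosGen ζ = t at hcub hρ hθ ht
  lift t to F using ht
  lift i to F using hi
  have := neZero_two F
  have hcub' : t ^ 3 + t ^ 2 - 2 * t - 1 = 0 := Subtype.ext hcub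
  have hi2' : i ^ 2 = -1 := Subtype.ext hi2
  have hi0' : i ≠ 0 := mod_cast hi0
  have hc : (2 - t : L) ≠ 0 := hρ ▸ pow_ne_zero 2 hρ0
  have hc' : 2 - t ≠ 0 := fun e => hc (congrArg Subtype.val e)
  have hs2 : s ^ 2 = 16 * (21 * t ^ 2 - 14 * t - 10)
      + 16 * (22 + 34 * t - 38 * t ^ 2) / (2 - t) * ρ := by
    refine mul_left_cancel₀ hc ?_
    field_simp
    linear_combination ρ * hθ - (s ^ 2 - 16 * (21 * t ^ 2 - 14 * t - 10)) * hρ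
  refine mem_of_sqrt_mem_sup (c := 2 - t) (p := 16 * (21 * t ^ 2 - 14 * t - 10))
    (q := 16 * (22 + 34 * t - 38 * t ^ 2) / (2 - t)) (w := 2 ^ 4 * i * (t ^ 2 + t)) hρ hs hs2 ?_
    (mul_ne_zero (mul_ne_zero (pow_ne_zero 4 two_ne_zero) hi0') (sq_add_self_ne_zero hcub'))
  field_simp
  linear_combination (-256 : F) * odd_sq_sub_even_sq hcub' - 256 * (t ^ 2 + t) ^ 2 * hi2'

theorem s_mem_of_x_mem_sup (h : IsSevenData b i ζ s x y) (hi : i ∈ F) (hζ : ζ ∈ F)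
    (hx : x ∈ F ⊔ K⟮s⟯) : s ∈ F := by
  obtain ⟨hb, hi2, hζ7, hs, hx2, -⟩ := h
  lift i to F using hi
  lift ζ to F using hζ
  have := neZero_two F
  replace hi2 : i ^ 2 = -1 := Subtype.ext hi2
  replace hζ7 : IsPrimitiveRoot ζ 7 := hζ7.of_map_of_injective F.val.injective
  have hcub := cosGen_cubic hζ7
  have hρ := sinGen_sq hi2 hζ7
  have hρ0 := ne_zero_of_sq_eq_two_sub (seven_ne_zero_of_isPrimitiveRoot hζ7) hcub hρ
  have hnorm := neg_theta_mul_norm hcub hρ (omegaOne_eq hζ7) (sinGen_mul_thetaOne hi2 hζ7)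
  have hm := sqrt_theta_mul_norm_ne_zero hcub hρ
  generalize 8 * (9 + 14 * cosGen ζ - _ + _) = m at hnorm hm
  have hi0 : i ≠ 0 := by rintro rfl; simp at hi2
  have hb0 : algebraMap K F b ≠ 0 := by simpa using hb
  refine mem_of_sqrt_mem_sup (c := thetaOne i ζ) (p := omegaOne i ζ * algebraMap K F b)
    (q := 1 / 2 * algebraMap K F b) (w := i * algebraMap K F b * m / (2 * sinGen i ζ))
    (hs.trans (map_thetaOne F.val i ζ).symm) hx
    (hx2.trans (congrArg (· * _ + _) (map_omegaOne F.val i ζ).symm)) ?_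
    (div_ne_zero (mul_ne_zero (mul_ne_zero hi0 hb0) hm) (mul_ne_zero two_ne_zero hρ0))
  rw [div_pow, eq_div_iff (pow_ne_zero 2 (mul_ne_zero two_ne_zero hρ0))]
  field_simp
  linear_combination (-1 : F) * hnorm - m ^ 2 * hi2

theorem x_mem_of_y_mem_sup (h : IsSevenData b i ζ s x y) (hi : i ∈ F) (hζ : ζ ∈ F) (hs : s ∈ F)
    (hy : y ∈ F ⊔ K⟮x⟯) : x ∈ F := by
  have hu0 := ne_zero_of_psiSeven h.psiSeven_eq_zero
  have hu1 := add_one_ne_zero_of_psiSeven h.psiSeven_eq_zero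
  have hx2 := h.x_sq_eq
  have hy2 := h.y_sq
  have hu : omegaOne i ζ + 1 / 2 * s ∈ F :=
    add_mem (omegaOne_mem hi hζ) (mul_mem (div_mem (one_mem F) (ofNat_mem F 2)) hs)
  generalize omegaOne i ζ + 1 / 2 * s = u at hu0 hu1 hx2 hy2 hu
  have hi2 := h.i_sq
  have hi0 := h.i_ne
  have hb0 : algebraMap K F b ≠ 0 := by simpa using h.b_ne
  lift i to F using hi
  lift u to F using hu
  have hu0' : u ≠ 0 := mod_cast hu0
  have hu1' : u + 1 ≠ 0 := mod_cast hu1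
  have hi2' : i ^ 2 = -1 := Subtype.ext hi2
  have hi0' : i ≠ 0 := mod_cast hi0
  refine mem_of_sqrt_mem_sup (c := algebraMap K F b * u) (p := 0)
    (q := (u + 1) * algebraMap K F b)
    (w := i * ((u + 1) * algebraMap K F b) * (algebraMap K F b * u)) hx2 hy
    (hy2.trans (zero_add _).symm) ?_ ?_
  · linear_combination (-((u + 1) * algebraMap K F b * (algebraMap K F b * u)) ^ 2) * hi2'
  · exact mul_ne_zero (mul_ne_zero hi0' (mul_ne_zero hu1' hb0)) (mul_ne_zero hb0 hu0')

end IsSevenData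

end Data

section Degree

open IntermediateField WeierstrassCurve.Affine

variable {K L : Type*} [Field K] [Field L] [Algebra K L] {b : K} {i ζ s x y : L}

theorem adjoin_pair_eq_sup (a c : L) : adjoin K {a, c} = adjoin K {a} ⊔ K⟮c⟯ := by
  rw [Set.pair_comm, ← Set.singleton_union, ← sup_comm, adjoin_union]

theorem adjoin_triple_eq_sup (a c d : L) : adjoin K {a, c, d} = adjoin K {a, c} ⊔ K⟮d⟯ := by
  rw [← adjoin_union]
  congr 1
  ext z
  simp [or_comm, or_left_comm]

theorem cosGen_mem {F : IntermediateField K L} (hζ : IsPrimitiveRoot ζ 7) (h : ζ + ζ⁻¹ ∈ F) :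
    cosGen ζ ∈ F := by
  rw [cosGen_eq hζ]
  exact sub_mem (pow_mem h 2) (ofNat_mem F 2)

theorem mem_holding {c : Cond} : c ∈ holding K i ζ s x y ↔ c.Holds K i ζ s x y := by
  simp [holding]

namespace IsSevenData

variable [NeZero (2 : L)]

theorem adjoin_i_zeta (h : IsSevenData b i ζ s x y) :
    adjoin K {i, ζ} = adjoin K {i, ζ + ζ⁻¹} ⊔ K⟮sinGen i ζ⟯ := by
  apply le_antisymm
  · have hle : adjoin K {i, ζ + ζ⁻¹} ≤ adjoin K {i, ζ + ζ⁻¹} ⊔ K⟮sinGen i ζ⟯ := le_sup_left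
    have hi := hle (mem_adjoin_pair_left K i (ζ + ζ⁻¹))
    have ht := hle (cosGen_mem h.prim (mem_adjoin_pair_right K i (ζ + ζ⁻¹)))
    have hρ := (le_sup_right : _ ≤ adjoin K {i, ζ + ζ⁻¹} ⊔ K⟮sinGen i ζ⟯)
      (mem_adjoin_simple_self K _)
    refine adjoin_le_iff.2 ?_
    rintro _ (rfl | rfl)
    exacts [hi, h.zeta_mem hi ht hρ]
  · have hi := mem_adjoin_pair_left K i ζ
    have hζ := mem_adjoin_pair_right K i ζ
    refine sup_le (adjoin_le_iff.2 ?_) (adjoin_simple_le_iff.2 (sinGen_mem hi hζ))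
    rintro _ (rfl | rfl)
    exacts [hi, add_mem hζ (inv_mem hζ)]

theorem adjoin_i_zeta_x (h : IsSevenData b i ζ s x y) :
    adjoin K {i, ζ, x} = adjoin K {i, ζ, s} ⊔ K⟮x⟯ := by
  rw [adjoin_triple_eq_sup, adjoin_triple_eq_sup, sup_assoc, sup_comm K⟮s⟯, ← sup_assoc, eq_comm,
    sup_eq_left, adjoin_simple_le_iff, ← adjoin_triple_eq_sup]
  exact h.s_mem (mem_adjoin_of_mem K (by simp)) (mem_adjoin_of_mem K (by simp))
    (mem_adjoin_of_mem K (by simp))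

theorem isAdmissible_holding (h : IsSevenData b i ζ s x y) :
    IsAdmissible (holding K i ζ s x y) := by
  have mem {S : Set L} {a : L} (ha : a ∈ S) : a ∈ adjoin K S := subset_adjoin K _ ha
  simp only [IsAdmissible, mem_holding]
  refine ⟨mt fun hs => ?_, mt fun hx => ?_, mt fun hy => ?_⟩
  · exact h.zeta_mem_of_s_mem_sup (mem (by simp)) (cosGen_mem h.prim (mem (by simp)))
      (h.adjoin_i_zeta.le hs)
  · exact h.s_mem_of_x_mem_sup (mem (by simp)) (mem (by simp)) ((adjoin_triple_eq_sup i ζ s).le hx)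
  · exact h.x_mem_of_y_mem_sup (mem (by simp)) (mem (by simp)) (mem (by simp))
      (h.adjoin_i_zeta_x.le hy)

open scoped Classical in
theorem finrank_adjoin_i_zeta (h : IsSevenData b i ζ s x y) :
    Module.finrank K ↥(adjoin K {i, ζ}) = (if Cond.A.Holds K i ζ s x y then 2 else 1)
      * (if Cond.B1.Holds K i ζ s x y then 3 else 1)
      * (if Cond.B2.Holds K i ζ s x y then 2 else 1) := by
  have hi := mem_adjoin_pair_left K i (ζ + ζ⁻¹)
  have ht := cosGen_mem h.prim (mem_adjoin_pair_right K i (ζ + ζ⁻¹))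
  have hρ2 : sinGen i ζ ^ 2 ∈ adjoin K {i, ζ + ζ⁻¹} := by
    rw [sinGen_sq h.i_sq h.prim]
    exact sub_mem (ofNat_mem _ 2) ht
  have hρ : sinGen i ζ ∈ adjoin K {i, ζ + ζ⁻¹} ↔ ζ ∈ adjoin K {i, ζ + ζ⁻¹} :=
    ⟨h.zeta_mem hi ht, sinGen_mem hi⟩
  have hi2 : i ^ 2 ∈ (⊥ : IntermediateField K L) := h.i_sq ▸ neg_mem (one_mem _)
  rw [h.adjoin_i_zeta, finrank_sup_sqrt hρ2, adjoin_pair_eq_sup,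
    finrank_sup_cubic (add_inv_cubic h.prim), ← bot_sup_eq K⟮i⟯, finrank_sup_sqrt hi2]
  simp only [IntermediateField.finrank_bot, one_mul, bot_sup_eq, hρ, ← adjoin_pair_eq_sup]
  congr!

theorem finrank_adjoin (h : IsSevenData b i ζ s x y) :
    Module.finrank K ↥(adjoin K {i, ζ, x} ⊔ K⟮y⟯) = towerDegree (holding K i ζ s x y) := by
  have mem {S : Set L} {a : L} (ha : a ∈ S) : a ∈ adjoin K S := subset_adjoin K _ ha
  have hs2 : s ^ 2 ∈ adjoin K {i, ζ} :=
    h.s_sq ▸ thetaOne_mem (mem (by simp)) (mem (by simp))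
  have hx2 : x ^ 2 ∈ adjoin K {i, ζ, s} := by
    rw [h.x_sq_eq]
    exact mul_mem (IntermediateField.algebraMap_mem _ b)
      (add_mem (omegaOne_mem (mem (by simp)) (mem (by simp)))
        (mul_mem (div_mem (one_mem _) (ofNat_mem _ 2)) (mem (by simp))))
  have hx : x ∈ adjoin K {i, ζ, x} := mem (by simp)
  have hy2 : y ^ 2 ∈ adjoin K {i, ζ, x} := by
    rw [h.equation]
    exact add_mem (pow_mem hx 3) (mul_mem (IntermediateField.algebraMap_mem _ b) hx)
  have hC := finrank_sup_sqrt hs2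
  have hD := finrank_sup_sqrt hx2
  rw [← adjoin_triple_eq_sup, h.finrank_adjoin_i_zeta] at hC
  rw [← h.adjoin_i_zeta_x, hC] at hD
  rw [towerDegree_holding, finrank_sup_sqrt hy2, hD]
  congr!

theorem cosGen_mem_of_omegaOne_add_mem {M : IntermediateField K L} (h : IsSevenData b i ζ s x y)
    (hu : omegaOne i ζ + 1 / 2 * s ∈ M) : cosGen ζ ∈ M := by
  have hu' := h.isSevenTriple
  have hψ := quartic_coeff_ne_zero_of_psiSeven h.psiSeven_eq_zero
  generalize omegaOne i ζ + 1 / 2 * s = u at hu hu' hψ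
  lift u to M using hu
  exact mem_of_cubic_of_quadratic hu'.cubic (a := 2 * u ^ 4 - 16 * u ^ 3 + 20 * u ^ 2 - 6)
    (b := -u ^ 4 - 44 * u ^ 3 + 10 * u ^ 2 - 12 * u - 17)
    (c := 40 * u ^ 3 - 24 * u ^ 2 - 8 * u - 8) hu'.quartic
    (hψ.imp (mt (congrArg Subtype.val)) (mt (congrArg Subtype.val)))

theorem zeta_mem_of_x_mem {M : IntermediateField K L} (h : IsSevenData b i ζ s x y)
    (hi : i ∈ M) (hx : x ∈ M) : ζ ∈ M := by
  have hu : omegaOne i ζ + 1 / 2 * s ∈ M := by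
    rw [← mul_div_cancel_left₀ (omegaOne i ζ + 1 / 2 * s) h.algebraMap_ne, ← h.x_sq_eq]
    exact div_mem (pow_mem hx 2) (M.algebraMap_mem b)
  have ht := h.cosGen_mem_of_omegaOne_add_mem hu
  refine h.zeta_mem hi ht ?_
  have hu' := h.isSevenTriple
  have hq := hu'.quadratic_coeff_ne_zero
  rw [eq_div_of_mul_eq hq (eq_neg_of_add_eq_zero_left hu'.quadratic)]
  generalize omegaOne i ζ + 1 / 2 * s = u at hu ⊢
  generalize cosGen ζ = t at ht ⊢
  lift u to M using hu
  lift t to M using ht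
  exact (-(4 * ((1 + 2 * t - 3 * t ^ 2) * u + t ^ 2 - 2 * t - 1))
    / (u ^ 2 - 2 * (1 + 4 * t - 2 * t ^ 2) * u + 1 - 4 * t ^ 2)).2

theorem divisionField_le {M : IntermediateField K L} (h : IsSevenData b i ζ s x y) (hi : i ∈ M)
    (hx : x ∈ M) (hy : y ∈ M) : divisionField (curve b) L 7 ≤ M := by
  classical
  have : Fact (Nat.Prime 7) := ⟨by norm_num⟩
  obtain ⟨hfin, hcard⟩ := finite_seven_torsion (W := ((curve b).baseChange L).toAffine)
    (seven_ne_zero_of_isPrimitiveRoot h.prim)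
  refine adjoin_le_iff.2 ?_
  rintro z ⟨x', y', h', h7', hz⟩
  obtain ⟨m, n, hmn⟩ := exists_eq_nsmul_add_nsmul (by norm_num) (mulI_mulI h.i_sq) hfin hcard
    (Point.some_ne_zero h.nonsingular) h.seven_smul (by convert h7')
  have hP := some_mem_range_map hx hy h.nonsingular
  have hJP := some_mem_range_map (neg_mem hx) (mul_mem hi hy)
    (nonsingular_mulI h.i_sq h.nonsingular)
  obtain ⟨hx', hy'⟩ := mem_of_some_mem_range_map
    (hmn ▸ add_mem (nsmul_mem hP m) (nsmul_mem hJP n))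
  rcases hz with rfl | rfl
  exacts [hx', hy']

theorem le_divisionField (h : IsSevenData b i ζ s x y) :
    adjoin K {i, ζ, x} ⊔ K⟮y⟯ ≤ divisionField (curve b) L 7 := by
  classical
  have mem {x' y' : L} (h' : ((curve b).baseChange L).toAffine.Nonsingular x' y')
      (h7 : 7 • Point.some x' y' h' = 0) :
      x' ∈ divisionField (curve b) L 7 ∧ y' ∈ divisionField (curve b) L 7 :=
    ⟨subset_adjoin K _ ⟨x', y', h', by convert h7, .inl rfl⟩,
      subset_adjoin K _ ⟨x', y', h', by convert h7, .inr rfl⟩⟩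
  obtain ⟨hx, hy⟩ := mem h.nonsingular h.seven_smul
  have hJ : 7 • mulI h.i_sq (Point.some x y h.nonsingular) = 0 := by
    rw [← map_nsmul, h.seven_smul, map_zero]
  have hiy : i * y ∈ divisionField (curve b) L 7 := (mem _ hJ).2
  have hi : i ∈ divisionField (curve b) L 7 := by
    rw [← mul_div_cancel_right₀ i h.y_ne]
    exact div_mem hiy hy
  refine sup_le (adjoin_le_iff.2 ?_) (adjoin_simple_le_iff.2 hy)
  rintro _ (rfl | rfl | rfl)
  exacts [hi, h.zeta_mem_of_x_mem hi hx, hx]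

theorem divisionField_eq (h : IsSevenData b i ζ s x y) :
    divisionField (curve b) L 7 = adjoin K {i, ζ, x} ⊔ K⟮y⟯ := by
  have hle : adjoin K {i, ζ, x} ≤ adjoin K {i, ζ, x} ⊔ K⟮y⟯ := le_sup_left
  exact le_antisymm
    (h.divisionField_le (hle (mem_adjoin_of_mem K (by simp))) (hle (mem_adjoin_of_mem K (by simp)))
      ((le_sup_right : _ ≤ adjoin K {i, ζ, x} ⊔ K⟮y⟯) (mem_adjoin_simple_self K y)))
    h.le_divisionField

theorem finrank_divisionField (h : IsSevenData b i ζ s x y) :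
    Module.finrank K (divisionField (curve b) L 7) = towerDegree (holding K i ζ s x y) := by
  rw [h.divisionField_eq, h.finrank_adjoin]

end IsSevenData

end Degree

section Transport

open IntermediateField WeierstrassCurve.Affine

variable {K L L' : Type*} [Field K] [Field L] [Algebra K L] [Field L'] [Algebra K L']
  {b : K} {i ζ s x y : L}

theorem exists_isSevenData (L : Type*) [Field L] [Algebra K L] [IsAlgClosed L]
    [NeZero ((7 : ℕ) : L)] (hb : b ≠ 0) : ∃ i ζ s x y : L, IsSevenData b i ζ s x y := by
  obtain ⟨i, hi⟩ := IsAlgClosed.exists_pow_nat_eq (-1 : L) two_pos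
  obtain ⟨ζ, hζ⟩ := HasEnoughRootsOfUnity.exists_primitiveRoot L 7
  obtain ⟨s, hs⟩ := IsAlgClosed.exists_pow_nat_eq (thetaOne i ζ) two_pos
  obtain ⟨x, hx⟩ := IsAlgClosed.exists_pow_nat_eq
    (omegaOne i ζ * algebraMap K L b + 1 / 2 * algebraMap K L b * s) two_pos
  obtain ⟨y, hy⟩ := IsAlgClosed.exists_pow_nat_eq
    ((omegaOne i ζ + 1 / 2 * s + 1) * algebraMap K L b * x) two_pos
  exact ⟨i, ζ, s, x, y, hb, hi, hζ, hs, hx, hy⟩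

namespace IsSevenData

theorem map_iff (σ : L →ₐ[K] L') :
    IsSevenData b (σ i) (σ ζ) (σ s) (σ x) (σ y) ↔ IsSevenData b i ζ s x y := by
  have hi : σ i ^ 2 = -1 ↔ i ^ 2 = -1 := by simp [← σ.injective.eq_iff]
  have hζ := IsPrimitiveRoot.map_iff_of_injective (ζ := ζ) (k := 7) σ.injective
  have hs : σ s ^ 2 = thetaOne (σ i) (σ ζ) ↔ s ^ 2 = thetaOne i ζ := by
    simp [← σ.injective.eq_iff, map_thetaOne]
  have hx : σ x ^ 2 = omegaOne (σ i) (σ ζ) * algebraMap K L' b + 1 / 2 * algebraMap K L' b * σ s ↔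
      x ^ 2 = omegaOne i ζ * algebraMap K L b + 1 / 2 * algebraMap K L b * s := by
    simp [← σ.injective.eq_iff, map_omegaOne, map_ofNat]
  have hy : σ y ^ 2 = (omegaOne (σ i) (σ ζ) + 1 / 2 * σ s + 1) * algebraMap K L' b * σ x ↔
      y ^ 2 = (omegaOne i ζ + 1 / 2 * s + 1) * algebraMap K L b * x := by
    simp [← σ.injective.eq_iff, map_omegaOne, map_ofNat]
  exact ⟨fun h => ⟨h.b_ne, hi.1 h.i_sq, hζ.1 h.prim, hs.1 h.s_sq, hx.1 h.x_sq, hy.1 h.y_sq⟩,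
    fun h => ⟨h.b_ne, hi.2 h.i_sq, hζ.2 h.prim, hs.2 h.s_sq, hx.2 h.x_sq, hy.2 h.y_sq⟩⟩

theorem extendScalars {F : Type*} [Field F] [Algebra K F] [Algebra F L] [IsScalarTower K F L]
    (h : IsSevenData b i ζ s x y) : IsSevenData (algebraMap K F b) i ζ s x y := by
  obtain ⟨hb, hi, hζ, hs, hx, hy⟩ := h
  rw [IsScalarTower.algebraMap_apply K F L] at hx hy
  exact ⟨(map_ne_zero _).2 hb, hi, hζ, hs, hx, hy⟩

variable [NeZero (2 : L)]

theorem map_divisionField (h : IsSevenData b i ζ s x y) (σ : L →ₐ[K] L') :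
    (divisionField (curve b) L 7).map σ = divisionField (curve b) L' 7 := by
  have : NeZero (2 : L') := ⟨map_ofNat σ 2 ▸ (map_ne_zero σ).2 two_ne_zero⟩
  rw [h.divisionField_eq, ((map_iff σ).2 h).divisionField_eq,
    IntermediateField.map_sup, adjoin_map, adjoin_map]
  simp only [Set.image_insert_eq, Set.image_singleton]

theorem mem_divisionField (h : IsSevenData b i ζ s x y) :
    i ∈ divisionField (curve b) L 7 ∧ ζ ∈ divisionField (curve b) L 7 ∧
      s ∈ divisionField (curve b) L 7 ∧ x ∈ divisionField (curve b) L 7 ∧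
        y ∈ divisionField (curve b) L 7 := by
  have hle := le_sup_left.trans h.le_divisionField
  have hi := hle (mem_adjoin_of_mem K (Set.mem_insert i _))
  have hζ := hle (mem_adjoin_of_mem K (show ζ ∈ {i, ζ, x} by simp))
  have hx := hle (mem_adjoin_of_mem K (show x ∈ {i, ζ, x} by simp))
  exact ⟨hi, hζ, h.s_mem hi hζ hx, hx,
    adjoin_simple_le_iff.1 (le_sup_right.trans h.le_divisionField)⟩

theorem algHom_comm (h : IsSevenData b i ζ s x y) {σ τ : L →ₐ[K] L} (hσ : σ i = i)
    (hτ : τ i = i) : σ (τ x) = τ (σ x) ∧ σ (τ y) = τ (σ y) := by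
  classical
  have : Fact (Nat.Prime 7) := ⟨by norm_num⟩
  obtain ⟨hfin, hcard⟩ := finite_seven_torsion (W := ((curve b).baseChange L).toAffine)
    (seven_ne_zero_of_isPrimitiveRoot h.prim)
  have hcomm := map_map_comm_of_map_comm (by norm_num) (mulI_mulI h.i_sq) hfin hcard
    (Point.some_ne_zero h.nonsingular) h.seven_smul (map_mulI σ h.i_sq h.i_sq hσ)
    (map_mulI τ h.i_sq h.i_sq hτ)
  simpa only [Point.map_some, Point.some.injEq] using hcomm

theorem algHom_ext (h : IsSevenData b i ζ s x y) (htop : divisionField (curve b) L 7 = ⊤)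
    {f g : L →ₐ[K] L'} (hi : f i = g i) (hx : f x = g x) (hy : f y = g y) : f = g := by
  let M : IntermediateField K L := (RingHom.eqLocusField (f : L →+* L') g).toIntermediateField
    fun a => by simp [RingHom.mem_eqLocusField]
  have hM : divisionField (curve b) L 7 ≤ M := h.divisionField_le hi hx hy
  exact AlgHom.ext fun z => hM (htop ▸ mem_top)

theorem aut_comm (h : IsSevenData b i ζ s x y) (htop : divisionField (curve b) L 7 = ⊤)
    {σ τ : L ≃ₐ[K] L} (hσ : σ i = i) (hτ : τ i = i) : σ * τ = τ * σ := by
  obtain ⟨hx, hy⟩ := h.algHom_comm (σ := (σ : L →ₐ[K] L)) (τ := (τ : L →ₐ[K] L)) hσ hτ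
  have hi : σ (τ i) = τ (σ i) := by rw [hσ, hτ, hσ]
  exact AlgEquiv.coe_toAlgHom_injective (h.algHom_ext htop hi hx hy)

theorem finrank_divisionField_algebraicClosure (h : IsSevenData b i ζ s x y)
    [Algebra.IsAlgebraic K L] (htop : divisionField (curve b) L 7 = ⊤) :
    Module.finrank K (divisionField (curve b) (AlgebraicClosure K) 7) = Module.finrank K L := by
  let σ : L →ₐ[K] AlgebraicClosure K := IsAlgClosed.lift
  rw [← h.map_divisionField σ, htop, ← (equivMap ⊤ σ).toLinearEquiv.finrank_eq, finrank_top']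

theorem divisionField_extendScalars (h : IsSevenData b i ζ s x y)
    (htop : divisionField (curve b) L 7 = ⊤) (F : IntermediateField K L) :
    divisionField (curve (algebraMap K F b)) L 7 = ⊤ := by
  obtain ⟨hi, -, -, hx, hy⟩ := (h.extendScalars (F := F)).mem_divisionField
  have hle := h.divisionField_le
    (M := (divisionField (curve (algebraMap K F b)) L 7).restrictScalars K) hi hx hy
  rwa [htop, top_le_iff, restrictScalars_eq_top_iff] at hle

end IsSevenData

end Transport

section Subgroups

theorem card_sup_of_coprime {G : Type*} [CommGroup G] {A B : Subgroup G}
    (h : (Nat.card A).Coprime (Nat.card B)) :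
    Nat.card ↥(A ⊔ B) = Nat.card A * Nat.card B := by
  have hdisj : B ⊓ A = ⊥ := (Subgroup.disjoint_of_coprime_natCard h).symm.eq_bot
  calc Nat.card ↥(A ⊔ B) = Nat.card B * B.relIndex (A ⊔ B) := by
        rw [← Subgroup.relIndex_bot_left, ← Subgroup.relIndex_bot_left,
          Subgroup.relIndex_mul_relIndex _ _ _ bot_le le_sup_right]
    _ = Nat.card B * (B ⊓ A).relIndex A := by
        rw [Subgroup.relIndex_sup_right, Subgroup.inf_relIndex_right]
    _ = Nat.card A * Nat.card B := by rw [hdisj, Subgroup.relIndex_bot_left, mul_comm]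

theorem exists_subgroup_card_of_dvd {G : Type*} [CommGroup G] [Finite G] {n : ℕ}
    (hn : n ∣ Nat.card G) : ∃ S : Subgroup G, Nat.card S = n := by
  induction n using Nat.recOnPosPrimePosCoprime with
  | zero => exact (Nat.card_pos.ne' (zero_dvd_iff.1 hn)).elim
  | one => exact ⟨⊥, Subgroup.card_bot⟩
  | prime_pow p k hp _ =>
    have := Fact.mk hp
    exact Sylow.exists_subgroup_card_pow_prime p hn
  | coprime a b _ _ hab iha ihb =>
    obtain ⟨A, hA⟩ := iha (dvd_of_mul_right_dvd hn)
    obtain ⟨B, hB⟩ := ihb (dvd_of_mul_left_dvd hn)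
    exact ⟨A ⊔ B, by rw [card_sup_of_coprime (hA.symm ▸ hB.symm ▸ hab), hA, hB]⟩

theorem eq_or_dvd_of_mem_degrees {d : ℕ} (hd : d ∈ degrees) : d = 96 ∨ d = 2 ^ 5 ∨ d ∣ 48 := by
  revert d
  decide

open scoped IsMulCommutative in
theorem exists_subgroup_card_of_mem_degrees {G : Type*} [Group G] (hG : Nat.card G = 96)
    {H : Subgroup G} [IsMulCommutative H] (hH : Nat.card H = 48) {d : ℕ} (hd : d ∈ degrees) :
    ∃ S : Subgroup G, Nat.card S = d := by
  have : Finite G := Nat.finite_of_card_ne_zero (by rw [hG]; norm_num)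
  rcases eq_or_dvd_of_mem_degrees hd with rfl | rfl | hd
  · exact ⟨⊤, by rw [Subgroup.card_top, hG]⟩
  · have := Fact.mk Nat.prime_two
    exact Sylow.exists_subgroup_card_pow_prime 2 (by rw [hG]; norm_num)
  · obtain ⟨S, hS⟩ := exists_subgroup_card_of_dvd (hH.symm ▸ hd)
    exact ⟨S.map H.subtype, by rw [Subgroup.card_subtype, hS]⟩

end Subgroups

section Occurrence

open IntermediateField

namespace IsSevenData

section Rational

variable {L : Type*} [Field L] [Algebra ℚ L] {b : ℚ} {i ζ s x y : L}

theorem twelve_dvd_finrank_adjoin_i_zeta (h : IsSevenData b i ζ s x y) :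
    12 ∣ Module.finrank ℚ ↥(adjoin ℚ {i, ζ}) := by
  have := charZero_of_injective_algebraMap (algebraMap ℚ L).injective
  have hi : orderOf i = 2 ^ (1 + 1) := orderOf_eq_prime_pow (by rw [pow_one, h.i_sq]; norm_num)
    (by rw [pow_succ, pow_one, pow_mul, h.i_sq]; norm_num)
  have hζ := h.prim.eq_orderOf
  have hprim : IsPrimitiveRoot (i * ζ) 28 := by
    rw [IsPrimitiveRoot.iff_orderOf, (Commute.all i ζ).orderOf_mul_eq_mul_orderOf_of_coprime]
    all_goals norm_num [hi, ← hζ]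
  have hdeg : Module.finrank ℚ ℚ⟮i * ζ⟯ = 12 := by
    rw [adjoin.finrank (hprim.isIntegral (by norm_num)).tower_top,
      ← hprim.minpoly_eq_cyclotomic_of_irreducible
        (Polynomial.cyclotomic.irreducible_rat (by norm_num)), Polynomial.natDegree_cyclotomic]
    rfl
  rw [← hdeg]
  exact finrank_dvd_of_le_right (adjoin_simple_le_iff.2
    (mul_mem (mem_adjoin_pair_left ℚ i ζ) (mem_adjoin_pair_right ℚ i ζ)))

theorem holds_rat (h : IsSevenData b i ζ s x y) (c : Cond) : c.Holds ℚ i ζ s x y := by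
  have := charZero_of_injective_algebraMap (algebraMap ℚ L).injective
  obtain ⟨hA, hB1, hB2⟩ : Cond.A.Holds ℚ i ζ s x y ∧ Cond.B1.Holds ℚ i ζ s x y ∧
      Cond.B2.Holds ℚ i ζ s x y := by
    have hdvd := h.finrank_adjoin_i_zeta ▸ h.twelve_dvd_finrank_adjoin_i_zeta
    split_ifs at hdvd with hA hB1 hB2
    · exact ⟨hA, hB1, hB2⟩
    all_goals norm_num at hdvd
  obtain ⟨hC, hD, hE⟩ := h.isAdmissible_holding
  simp only [mem_holding] at hC hD hE
  cases c
  exacts [hA, hB1, hB2, hC hB2, hD (hC hB2), hE (hD (hC hB2))]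

theorem finrank_rat (h : IsSevenData b i ζ s x y) :
    Module.finrank ℚ (divisionField (curve b) L 7) = 96 := by
  have := charZero_of_injective_algebraMap (algebraMap ℚ L).injective
  rw [h.finrank_divisionField, towerDegree_holding]
  simp only [h.holds_rat, if_true]

theorem finrank_adjoin_i_rat (h : IsSevenData b i ζ s x y) : Module.finrank ℚ ℚ⟮i⟯ = 2 := by
  have hi : i ^ 2 ∈ (⊥ : IntermediateField ℚ L) := h.i_sq ▸ neg_mem (one_mem _)
  rw [← bot_sup_eq ℚ⟮i⟯, finrank_sup_sqrt hi, IntermediateField.finrank_bot, one_mul]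
  exact if_pos (h.holds_rat .A)

end Rational

section Galois

variable {K L : Type*} [Field K] [Field L] [Algebra K L] [NeZero (2 : L)] {b : K} {i ζ s x y : L}

theorem isMulCommutative_fixingSubgroup (h : IsSevenData b i ζ s x y)
    (htop : divisionField (curve b) L 7 = ⊤) : IsMulCommutative (fixingSubgroup K⟮i⟯) := by
  have hfix {σ : L ≃ₐ[K] L} (hσ : σ ∈ fixingSubgroup K⟮i⟯) : σ i = i :=
    (mem_fixingSubgroup_iff _ _).1 hσ _ (mem_adjoin_simple_self K i)
  exact ⟨⟨fun σ τ => Subtype.ext (h.aut_comm htop (hfix σ.2) (hfix τ.2))⟩⟩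

theorem exists_intermediateField_finrank_eq [IsGalois K L] (h : IsSevenData b i ζ s x y)
    (htop : divisionField (curve b) L 7 = ⊤) (hL : Module.finrank K L = 96)
    (hi : Module.finrank K K⟮i⟯ = 2) {d : ℕ} (hd : d ∈ degrees) :
    ∃ F : IntermediateField K L, Module.finrank F
      (divisionField (curve (algebraMap K F b)) (AlgebraicClosure F) 7) = d := by
  have : FiniteDimensional K L := Module.finite_of_finrank_pos (by rw [hL]; norm_num)
  have hG : Nat.card (L ≃ₐ[K] L) = 96 := by rw [IsGalois.card_aut_eq_finrank, hL]
  have hH : Nat.card (fixingSubgroup K⟮i⟯) = 48 := by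
    have hmul := Module.finrank_mul_finrank K K⟮i⟯ L
    rw [hi, hL] at hmul
    rw [IsGalois.card_fixingSubgroup_eq_finrank]
    omega
  have := h.isMulCommutative_fixingSubgroup htop
  obtain ⟨S, hS⟩ := exists_subgroup_card_of_mem_degrees hG hH hd
  refine ⟨fixedField S, ?_⟩
  rw [h.extendScalars.finrank_divisionField_algebraicClosure
    (h.divisionField_extendScalars htop _), finrank_fixedField_eq_card, hS]

theorem normal_divisionField [Normal K L] (h : IsSevenData b i ζ s x y) :
    Normal K (divisionField (curve b) L 7) :=
  normal_iff_forall_map_le.2 fun σ => (h.map_divisionField σ).le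

theorem divisionField_divisionField (h : IsSevenData b i ζ s x y) :
    (∃ i ζ s x y : divisionField (curve b) L 7, IsSevenData b i ζ s x y) ∧
      divisionField (curve b) (divisionField (curve b) L 7) 7 = ⊤ := by
  obtain ⟨hi, hζ, hs, hx, hy⟩ := h.mem_divisionField
  generalize htop : divisionField (curve b) L 7 = D at hi hζ hs hx hy
  lift i to D using hi
  lift ζ to D using hζ
  lift s to D using hs
  lift x to D using hx
  lift y to D using hy
  have hD := (map_iff D.val).1 h
  have := neZero_two D
  refine ⟨⟨i, ζ, s, x, y, hD⟩, map_injective D.val ?_⟩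
  rw [hD.map_divisionField, htop, ← AlgHom.fieldRange_eq_map, fieldRange_val]

end Galois

end IsSevenData

universe u

theorem exists_isGalois_isSevenData {K : Type u} [Field K] [CharZero K] {b : K} (hb : b ≠ 0) :
    ∃ (L : Type u) (_ : Field L) (_ : Algebra K L) (_ : IsGalois K L) (i ζ s x y : L),
      IsSevenData b i ζ s x y ∧ divisionField (curve b) L 7 = ⊤ := by
  obtain ⟨i, ζ, s, x, y, h⟩ := exists_isSevenData (AlgebraicClosure K) hb
  obtain ⟨⟨i', ζ', s', x', y', h'⟩, htop⟩ := h.divisionField_divisionField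
  have := h.normal_divisionField
  exact ⟨divisionField (curve b) (AlgebraicClosure K) 7, _, _, ⟨⟩, i', ζ', s', x', y', h', htop⟩

theorem exists_numberField_finrank_eq {b : ℚ} (hb : b ≠ 0) {d : ℕ} (hd : d ∈ degrees) :
    ∃ (K : Type) (_ : Field K) (_ : NumberField K),
      Module.finrank K (divisionField (curve (b : K)) (AlgebraicClosure K) 7) = d := by
  obtain ⟨L, _, _, _, i, ζ, s, x, y, h, htop⟩ := exists_isGalois_isSevenData hb
  have hL : Module.finrank ℚ L = 96 := by rw [← finrank_top', ← htop, h.finrank_rat]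
  have : FiniteDimensional ℚ L := Module.finite_of_finrank_pos (by rw [hL]; norm_num)
  have : NumberField L := .of_module_finite ℚ L
  obtain ⟨F, hF⟩ := h.exists_intermediateField_finrank_eq htop hL h.finrank_adjoin_i_rat hd
  rw [eq_ratCast] at hF
  exact ⟨F, inferInstance, inferInstance, hF⟩

end Occurrence

end DivisionFieldSeven

open DivisionFieldSeven in
theorem theorem2_general :
    (∀ (K : Type*) [Field K] (L : Type*) [Field L] [Algebra K L] [NeZero (2 : L)] (b : K), b ≠ 0 →
      ∀ i ζ s x₁ y₁ : L, i ^ 2 = -1 → IsPrimitiveRoot ζ 7 → s ^ 2 = thetaOne i ζ →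
        x₁ ^ 2 = omegaOne i ζ * algebraMap K L b + 1 / 2 * algebraMap K L b * s →
        y₁ ^ 2 = (omegaOne i ζ + 1 / 2 * s + 1) * algebraMap K L b * x₁ →
        Module.finrank K (divisionField (curve b) L 7) ∈ degrees ∧
        ∀ d : ℕ, Module.finrank K (divisionField (curve b) L 7) = d ↔
          Table d (holding K i ζ s x₁ y₁)) ∧
    (∀ b : ℚ, b ≠ 0 → ∀ d ∈ degrees, ∃ (K : Type) (_ : Field K) (_ : NumberField K),
      Module.finrank K (divisionField (curve (b : K)) (AlgebraicClosure K) 7) = d) := by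
  refine ⟨?_, fun b hb d hd => exists_numberField_finrank_eq hb hd⟩
  intro K _ L _ _ _ b hb i ζ s x₁ y₁ hi hζ hs hx hy
  have h : IsSevenData b i ζ s x₁ y₁ := ⟨hb, hi, hζ, hs, hx, hy⟩
  rw [h.finrank_divisionField]
  exact ⟨h.isAdmissible_holding.towerDegree_mem, fun d => h.isAdmissible_holding.towerDegree_eq_iff⟩

open DivisionFieldSeven in
theorem theorem2 :
    (∀ (K : Type*) [Field K] [NumberField K] (Kbar : Type*) [Field Kbar] [Algebra K Kbar]
      [IsAlgClosure K Kbar] (b : K), b ≠ 0 →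
      ∀ i ζ s x₁ y₁ : Kbar, i ^ 2 = -1 → IsPrimitiveRoot ζ 7 →
        s ^ 2 = thetaOne i ζ →
        x₁ ^ 2 = omegaOne i ζ * algebraMap K Kbar b + 1 / 2 * algebraMap K Kbar b * s →
        y₁ ^ 2 = (omegaOne i ζ + 1 / 2 * s + 1) * algebraMap K Kbar b * x₁ →
        Module.finrank K (divisionField (curve b) Kbar 7) ∈ degrees ∧
        ∀ d : ℕ, Module.finrank K (divisionField (curve b) Kbar 7) = d ↔
          Table d (holding K i ζ s x₁ y₁)) ∧
    (∀ d ∈ degrees, ∃ (K : Type) (_ : Field K) (_ : NumberField K) (b : K), b ≠ 0 ∧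
      Module.finrank K (divisionField (curve b) (AlgebraicClosure K) 7) = d) := by
  refine ⟨fun K _ _ Kbar _ _ _ => ?_, fun d hd => ?_⟩
  · have := charZero_of_injective_algebraMap (algebraMap K Kbar).injective
    exact theorem2_general.1 K Kbar
  · obtain ⟨K, _, _, hK⟩ := theorem2_general.{0, 0}.2 1 one_ne_zero d hd
    exact ⟨K, inferInstance, inferInstance, ((1 : ℚ) : K), by simp, hK⟩
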